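/- **Setting.** Let $d,p\ge 1$, let $X_1,X_2,\dots\in\mathbb R^d$ be nonrandom, and let $Y_i=f(X_i)+\varepsilon_i\in\mathbb R^p$ $(i\le n)$. The hypothesis $H_0$ is $f\le 0$ at the design points. *Smoothness.* For $\tau>0$ let $[\tau]$ be the largest integer strictly smaller than $\tau$. $\mathcal F(\tau,L)$ is the set of $g:\mathbb R^d\to\mathbb R$ with continuous partial derivatives up to order $[\tau]$ and $|D^\alpha g(x)-D^\alpha g(y)|\le L\|x-y\|^{\tau-[\tau]}$ for all $|\alpha|=[\tau]$ and all $x,y$. Write $g^{(k,l)}(x)$ for the $k$-th derivative in the direction $l$, $\|l\|=1$. For $\tau>1$ and $1\le\varsigma\le[\tau]$, $\mathcal F_\varsigma(\tau,L)$ is the set of $g\in\mathcal F(\tau,L)$ such that $g^{(1,l)}(x)=0$ implies $g^{(k,l)}(x)=0$ for $k=1,\dots,\varsigma$, and such that $g^{(1,l)}(x)=0\neq g^{(\varsigma+1,l)}(x)$ for some $x,l$. For $\tau\le1$ put $\varsigma=0$ and $\mathcal F_0(\tau,L)=\mathcal F(\tau,L)$. Let $\zeta=\min(\varsigma+1,\tau)$.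 *Models.* Fix constants $\tau\ge 1/4$, $L>0$, $\varsigma$ as above, and $C_{\rm reg},\delta,C_{\rm mom},C_{\rm Lip},c_{\rm var}>0$. For sample size $n$, $\mathcal G=\mathcal G_n$ is the class of models $w=(f,\text{law of }\varepsilon)$ with $f_m\in\mathcal F_\varsigma(\tau,L)$ for all $m$ and, if $\varsigma<[\tau]$, $|D^\alpha f_m|\le C_{\rm reg}$ for $|\alpha|=\varsigma+1$; and with independent mean-zero $\varepsilon_1,\dots,\varepsilon_n$ such that $E|\varepsilon_{i,m}|^{4+\delta}\le C_{\rm mom}$, such that the second mixed moments $\Sigma_{i,m_1m_2}=E[\varepsilon_{i,m_1}\varepsilon_{i,m_2}]$ and the fourth mixed moments of $\varepsilon_i$ and of $\varepsilon_j$ differ by at most $C_{\rm Lip}\|X_i-X_j\|$, and such that $\Sigma_{i,mm}\ge c_{\rm var}$. *Test.* Let $H_n=\{h_{\max}a^k:0\le k\le k_n\}$ with $a\in(0,1)$, $h_{\max}>0$, $h_{\min}=h_{\max}a^{k_n}\to0$ and $|H_n|\le C\log n$. For $h\in H_n$ let $I_h\subseteq\{1,\dots,n\}$ be such that the points $X_i$,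 $i\in I_h$, have mutual distances $>2h$ and every $X_i$, $i\le n$, is within $2h$ of one of them. Let $S_n=\{(i,m,h):h\in H_n,\ i\in I_h,\ 1\le m\le p\}$, $K_h(x)=K(x/h)/h^d$, and $w_h(X_i,X_j)=K_h(X_i-X_j)/\sum_{k\le n}K_h(X_i-X_k)$, with a kernel $0\le K\le 1$ that vanishes for $\|x\|>1$ and is bounded below by a positive constant (smaller than 1) on $\|x\|\le1/2$. With positive semidefinite estimators $\hat\Sigma_i=\hat\Sigma_i(Y_1,\dots,Y_n)$ put, for $s=(i,m,h)$, $\hat f_s=\sum_j w_h(X_i,X_j)Y_{j,m}$, $\hat V_s^2=\sum_j w_h^2(X_i,X_j)\hat\Sigma_{j,mm}$, and $\hat T=\max_{s\in S_n}\hat f_s/\hat V_s$. Let $g_0:\mathbb R\to[0,1]$ be thrice differentiable, equal to $1$ on $(-\infty,0]$ and to $0$ on $[1,\infty)$, let $\beta_n>0$ be bounded, $\alpha\in(0,1)$, and $0<\gamma_n\le\bar\gamma<\alpha/2$. Given the data, let $\tilde Y_j\sim N(0,\hat\Sigma_j)$ be independent, and for $A\subseteq S_n$ let $T^A=\max_{(i,m,h)\in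 A}\sum_jw_h(X_i,X_j)\tilde Y_{j,m}/\hat V_{i,m,h}$. The critical value $c^{PIA}_{1-\lambda}$ solves $E[g_0((T^{S_n}-c)/\beta_n)\mid Y]=1-\lambda$; and $c^{RMS}$ solves $E[g_0((T^{A}-c)/\beta_n)\mid Y]=1-\alpha+2\gamma_n$ for $A=S^{RMS}=\{s\in S_n:\hat f_s/\hat V_s>-2(c^{PIA}_{1-\gamma_n}+\beta_n)\}$. Alternatively, these conditional expectations are replaced by averages over $B_n\ge1$ independent simulated draws of $\tilde Y$ (fresh ones in the second step of RMS). The test accepts $H_0$ with probability $g^P_{1-\alpha}(\hat T)=g_0((\hat T-c)/\beta_n)$, where $c=c^{PIA}_{1-\alpha}$ for $P=PIA$ and $c=c^{RMS}$ for $P=RMS$. *Further assumptions.* $\|X_i\|<h_{\max}$ for all $i$. For some $0<C_1<C_2$ and all large $n$, the number $M_h(x)$ of $j\le n$ with $\|X_j-x\|\le h$ satisfies $C_1nh^d\le M_h(X_i)\le C_2nh^d$ for all $i\in\mathbb N$, $h\in H_n$, and also $M_{h_{\min}/2}(X_i)\ge C_1n(h_{\min}/2)^d$ for $i\le n$. For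 some $\phi\in(0,1/(2+d))$, $\max_{i\le n}\|\hat\Sigma_i-\Sigma_i\|=o_p(n^{-(1/(2+d)-\phi)})$ in spectral norm, uniformly over $\mathcal G$. Finally $(\log n)^4/(\beta_n^{10}h_{\min}^{3d}n)\to0$. *Distance.* Let $S=\mathrm{cl}\{X_i:i\in\mathbb N\}$ and $S_\vartheta=\{x\in S:B_\vartheta(x)\subset S\}$. Put $\vartheta_n=4\sqrt d\,h_{\min}$ if $\zeta\le d$ and $\vartheta_n=4\sqrt d(\log n/n)^{1/(2\zeta+d)}$ if $\zeta>d$, and $\rho_{\vartheta_n}(w,H_0)=\sup\{[f^w_m(X_i)]_+:\ i\in\mathbb N,\ X_i\in S_{\vartheta_n},\ 1\le m\le p\}$. **Theorem 4.** For $P=PIA$ and $P=RMS$, with exact as well as with simulated critical values: (i) If $\zeta\le d$, there is a $C_0>0$, depending only on $d$, $p$ and the constants of the class $\mathcal G$, such that for every $C\ge C_0$, as $n\to\infty$, $$\sup\{E_w[g^P_{1-\alpha}(\hat T)]:\ w\in\mathcal G,\ \rho_{\vartheta_n}(w,H_0)\ge C h_{\min}^{\zeta}\}\to0 .$$ (ii)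 If $\zeta>d$ and $h_{\min}<(\log n/n)^{1/(2\zeta+d)}$ for all large $n$, then for every sequence $r_n$ with $r_n(n/\log n)^{\zeta/(2\zeta+d)}\to\infty$, as $n\to\infty$, $$\sup\{E_w[g^P_{1-\alpha}(\hat T)]:\ w\in\mathcal G,\ \rho_{\vartheta_n}(w,H_0)\ge r_n\}\to0 .$$ -/

import Mathlib

open Filter Topology MeasureTheory ProbabilityTheory
open scoped ENNReal

noncomputable section

/-! ### Smoothness classes -/

/-- `[τ]`: the largest integer strictly smaller than `τ` (for `τ > 0`). -/
def intBelow (τ : ℝ) : ℕ := ⌈τ⌉₊ - 1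

/-- The partial derivative `∂^k g / ∂x_{i 1} ⋯ ∂x_{i k}` at `x`. -/
def partialDeriv {d k : ℕ} (i : Fin k → Fin d) (g : EuclideanSpace ℝ (Fin d) → ℝ)
    (x : EuclideanSpace ℝ (Fin d)) : ℝ :=
  iteratedFDeriv ℝ k g x (fun j => EuclideanSpace.single (i j) (1 : ℝ))

/-- `g^{(k,l)}(x)`: the `k`-th derivative of `g` at `x` in the direction `l`. -/
def dirDeriv {d : ℕ} (k : ℕ) (l : EuclideanSpace ℝ (Fin d)) (g : EuclideanSpace ℝ (Fin d) → ℝ)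
    (x : EuclideanSpace ℝ (Fin d)) : ℝ :=
  iteratedDeriv k (fun t : ℝ => g (x + t • l)) 0

/-- The Hölder class `F(τ, L)`. -/
def HolderClass (d : ℕ) (τ L : ℝ) : Set (EuclideanSpace ℝ (Fin d) → ℝ) :=
  {g | ContDiff ℝ (intBelow τ : ℕ) g ∧
    ∀ (i : Fin (intBelow τ) → Fin d) (x y : EuclideanSpace ℝ (Fin d)),
      |partialDeriv i g x - partialDeriv i g y| ≤ L * ‖x - y‖ ^ (τ - intBelow τ)}

/-- The class `F_ς(τ, L)`; for `τ ≤ 1` (where `ς = 0`) it is the whole class `F(τ, L)`. In the last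
clause a nonzero value of `dirDeriv (ς + 1)` entails that this derivative exists. -/
def HolderSubclass (d : ℕ) (ς : ℕ) (τ L : ℝ) : Set (EuclideanSpace ℝ (Fin d) → ℝ) :=
  {g | g ∈ HolderClass d τ L ∧ (1 < τ →
    (∀ l : EuclideanSpace ℝ (Fin d), ‖l‖ = 1 → ∀ x, dirDeriv 1 l g x = 0 →
      ∀ k, 1 ≤ k → k ≤ ς → dirDeriv k l g x = 0) ∧
    ∃ l x : EuclideanSpace ℝ (Fin d), ‖l‖ = 1 ∧ dirDeriv 1 l g x = 0 ∧
      dirDeriv (ς + 1) l g x ≠ 0)}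

/-! ### Models -/

/-- The constants that are held fixed in the class of models. -/
structure ModelConstants where
  /-- order of Hölder smoothness -/
  τ : ℝ
  /-- Hölder constant -/
  L : ℝ
  /-- order up to which directional derivatives vanish with the first one -/
  ς : ℕ
  /-- bound on the partial derivatives of order `ς + 1`, when `ς < [τ]` -/
  Creg : ℝ
  /-- excess of the order of the moments of the disturbances over `4` -/
  δ : ℝ
  /-- bound on the moments of order `4 + δ` -/
  Cmom : ℝ
  /-- Lipschitz constant of the second and fourth moments -/
  Clip : ℝ
  /-- lower bound on the variances -/
  cvar : ℝ

/-- The admissible ranges of the constants. -/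
structure ModelConstants.Valid (c : ModelConstants) : Prop where
  τ_ge : 1 / 4 ≤ c.τ
  L_pos : 0 < c.L
  ς_range : (c.τ ≤ 1 ∧ c.ς = 0) ∨ (1 < c.τ ∧ 1 ≤ c.ς ∧ c.ς ≤ intBelow c.τ)
  Creg_pos : 0 < c.Creg
  δ_pos : 0 < c.δ
  Cmom_pos : 0 < c.Cmom
  Clip_pos : 0 < c.Clip
  cvar_pos : 0 < c.cvar

/-- `ζ = min (ς + 1, τ)`. -/
def ModelConstants.ζ (c : ModelConstants) : ℝ := min (c.ς + 1) c.τ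

/-- A model for sample size `n`: the regression function and the laws of the `n` independent
disturbances. -/
structure Model (d p n : ℕ) where
  f : Fin p → EuclideanSpace ℝ (Fin d) → ℝ
  law : Fin n → ProbabilityMeasure (EuclideanSpace ℝ (Fin p))

/-- `Σ_i`: the matrix of second moments of the `i`-th disturbance. -/
def Model.cov {d p n : ℕ} (w : Model d p n) (i : Fin n) : Matrix (Fin p) (Fin p) ℝ :=
  Matrix.of fun m₁ m₂ => ∫ e, e m₁ * e m₂ ∂(w.law i : Measure (EuclideanSpace ℝ (Fin p)))

/-- The fourth mixed moments of the `i`-th disturbance. -/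
def Model.mom4 {d p n : ℕ} (w : Model d p n) (i : Fin n) (m₁ m₂ m₃ m₄ : Fin p) : ℝ :=
  ∫ e, e m₁ * e m₂ * e m₃ * e m₄ ∂(w.law i : Measure (EuclideanSpace ℝ (Fin p)))

/-- The law of the responses `Y_i = f(X_i) + ε_i`, `i < n`, with independent disturbances. -/
def Model.dataLaw {d p n : ℕ} (X : ℕ → EuclideanSpace ℝ (Fin d)) (w : Model d p n) :
    Measure (Fin n → EuclideanSpace ℝ (Fin p)) :=
  (Measure.pi fun i => (w.law i : Measure (EuclideanSpace ℝ (Fin p)))).map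
    fun e i => WithLp.toLp 2 fun m => w.f m (X i) + e i m

/-- The class `𝒢` of models for sample size `n`, for the design `X` and the given constants. -/
structure InModelClass {d p n : ℕ} (c : ModelConstants) (X : ℕ → EuclideanSpace ℝ (Fin d))
    (w : Model d p n) : Prop where
  mean_zero : ∀ i m, ∫ e, e m ∂(w.law i : Measure (EuclideanSpace ℝ (Fin p))) = 0
  moment_le : ∀ i m, ∫⁻ e, ENNReal.ofReal (|e m| ^ (4 + c.δ))
    ∂(w.law i : Measure (EuclideanSpace ℝ (Fin p))) ≤ ENNReal.ofReal c.Cmom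
  cov_lipschitz : ∀ (i j : Fin n) m₁ m₂,
    |w.cov i m₁ m₂ - w.cov j m₁ m₂| ≤ c.Clip * ‖X i - X j‖
  mom4_lipschitz : ∀ (i j : Fin n) m₁ m₂ m₃ m₄,
    |w.mom4 i m₁ m₂ m₃ m₄ - w.mom4 j m₁ m₂ m₃ m₄| ≤ c.Clip * ‖X i - X j‖
  var_ge : ∀ i m, c.cvar ≤ w.cov i m m
  f_mem : ∀ m, w.f m ∈ HolderSubclass d c.ς c.τ c.L
  deriv_le : c.ς < intBelow c.τ → ∀ m (i : Fin (c.ς + 1) → Fin d) x,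
    |partialDeriv i (w.f m) x| ≤ c.Creg

/-- `S_ϑ`: the points of `S = cl {X_i : i ∈ ℕ}` whose `ϑ`-ball is contained in `S`. -/
def innerSet {d : ℕ} (X : ℕ → EuclideanSpace ℝ (Fin d)) (ϑ : ℝ) :
    Set (EuclideanSpace ℝ (Fin d)) :=
  {x | x ∈ closure (Set.range X) ∧ Metric.ball x ϑ ⊆ closure (Set.range X)}

/-- `ρ_ϑ(w, H₀)`: the supremum of the positive parts `[f_m(X_i)]₊` over all `m` and all `i ∈ ℕ`
with `X_i ∈ S_ϑ` (zero if there is no such `i`). -/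
def Model.dist {d p n : ℕ} (X : ℕ → EuclideanSpace ℝ (Fin d)) (ϑ : ℝ) (w : Model d p n) : ℝ≥0∞ :=
  ⨆ (i : ℕ) (_ : X i ∈ innerSet X ϑ) (m : Fin p), ENNReal.ofReal (w.f m (X i))

/-! ### The test -/

/-- Design points and all ingredients of the test. The observations of the sample of size `n` are
those with index `i < n`. -/
structure TestSetup (d p : ℕ) where
  /-- the infinite sequence of nonstochastic design points -/
  X : ℕ → EuclideanSpace ℝ (Fin d)
  /-- largest bandwidth -/
  hmax : ℝ
  /-- ratio of successive bandwidths -/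
  a : ℝ
  /-- the bandwidths for sample size `n` are `hmax * a ^ j`, `j = 0, …, k n` -/
  k : ℕ → ℕ
  /-- kernel -/
  K : EuclideanSpace ℝ (Fin d) → ℝ
  /-- `I n j`: test points for sample size `n` and bandwidth `hmax * a ^ j` -/
  I : (n : ℕ) → ℕ → Finset (Fin n)
  /-- estimators of the covariance matrices, as functions of the responses -/
  Sig : (n : ℕ) → (Fin n → EuclideanSpace ℝ (Fin p)) → Fin n → Matrix (Fin p) (Fin p) ℝ
  /-- smoothed indicator used for the randomized test -/
  g₀ : ℝ → ℝ
  /-- width of the randomization interval -/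
  β : ℕ → ℝ
  /-- nominal size -/
  α : ℝ
  /-- tuning parameter of the refined moment selection -/
  γ : ℕ → ℝ
  /-- number of bootstrap repetitions -/
  B : ℕ → ℕ

namespace TestSetup

variable {d p : ℕ} (t : TestSetup d p)

/-- The `j`-th bandwidth. -/
def bw (j : ℕ) : ℝ := t.hmax * t.a ^ j

/-- The smallest bandwidth `h_min` for sample size `n`. -/
def hmin (n : ℕ) : ℝ := t.bw (t.k n)

/-- `M_h(X_i)` for sample size `n`: the number of `j < n` with `‖X_j - X_i‖ ≤ h`. -/
def count (n : ℕ) (h : ℝ) (i : ℕ) : ℕ := Nat.card {j : Fin n // ‖t.X j - t.X i‖ ≤ h}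

/-- `K_h(x) = K(x / h) / h ^ d`. -/
def kern (h : ℝ) (x : EuclideanSpace ℝ (Fin d)) : ℝ := t.K (h⁻¹ • x) / h ^ d

/-- The weights `w_h(X_i, X_j)`. -/
def weight {n : ℕ} (h : ℝ) (i j : Fin n) : ℝ :=
  t.kern h (t.X i - t.X j) / ∑ l : Fin n, t.kern h (t.X i - t.X l)

/-- The index set `S` of triples (test point, component, number of the bandwidth). -/
def idx (n : ℕ) : Set (Fin n × Fin p × ℕ) := {s | s.2.2 ≤ t.k n ∧ s.1 ∈ t.I n s.2.2}

/-- The kernel smoother `∑_j w_h(X_i, X_j) y_{j,m}` at `s = (i, m, h)`. -/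
def smooth {n : ℕ} (y : Fin n → EuclideanSpace ℝ (Fin p)) (s : Fin n × Fin p × ℕ) : ℝ :=
  ∑ j, t.weight (t.bw s.2.2) s.1 j * y j s.2.1

/-- `V̂_s`. -/
def Vhat {n : ℕ} (y : Fin n → EuclideanSpace ℝ (Fin p)) (s : Fin n × Fin p × ℕ) : ℝ :=
  Real.sqrt (∑ j, t.weight (t.bw s.2.2) s.1 j ^ 2 * t.Sig n y j s.2.1 s.2.1)

/-- `max_{s ∈ A} (smooth z s / V̂_s)`, with `V̂` computed from the responses `y`. -/
def maxStat {n : ℕ} (y : Fin n → EuclideanSpace ℝ (Fin p)) (A : Set (Fin n × Fin p × ℕ))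
    (z : Fin n → EuclideanSpace ℝ (Fin p)) : ℝ :=
  ⨆ s : A, t.smooth z s / t.Vhat y s

/-- The test statistic `T̂`. -/
def That {n : ℕ} (y : Fin n → EuclideanSpace ℝ (Fin p)) : ℝ := t.maxStat y (t.idx n) y

/-- `S^RMS`, given the plug-in critical value `c` of level `1 - γ`. -/
def idxRMS {n : ℕ} (y : Fin n → EuclideanSpace ℝ (Fin p)) (c : ℝ) : Set (Fin n × Fin p × ℕ) :=
  {s | s ∈ t.idx n ∧ -2 * (c + t.β n) < t.smooth y s / t.Vhat y s}

/-- The law of one bootstrap sample given the responses `y`: independent `N(0, Σ̂_i)`, `i < n`. -/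
def bootLaw {n : ℕ} (y : Fin n → EuclideanSpace ℝ (Fin p)) :
    Measure (Fin n → EuclideanSpace ℝ (Fin p)) :=
  Measure.pi fun i => multivariateGaussian 0 (t.Sig n y i)

/-- The law of `B` independent bootstrap samples given the responses `y`. -/
def simLaw {n : ℕ} (y : Fin n → EuclideanSpace ℝ (Fin p)) :
    Measure (Fin (t.B n) → Fin n → EuclideanSpace ℝ (Fin p)) :=
  Measure.pi fun _ => t.bootLaw y

/-- `c` is an exact bootstrap critical value of level `lvl` for the maximum over `A`. -/
def IsCrit {n : ℕ} (y : Fin n → EuclideanSpace ℝ (Fin p)) (A : Set (Fin n × Fin p × ℕ))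
    (lvl c : ℝ) : Prop :=
  ∫ z, t.g₀ ((t.maxStat y A z - c) / t.β n) ∂(t.bootLaw y) = lvl

/-- `c` is a simulated bootstrap critical value of level `lvl` for the maximum over `A`, computed
from the simulated bootstrap samples `z 0, …, z (B - 1)`. -/
def IsSimCrit {n : ℕ} (y : Fin n → EuclideanSpace ℝ (Fin p)) (A : Set (Fin n × Fin p × ℕ))
    (z : Fin (t.B n) → Fin n → EuclideanSpace ℝ (Fin p)) (lvl c : ℝ) : Prop :=
  (∑ b, t.g₀ ((t.maxStat y A (z b) - c) / t.β n)) / t.B n = lvl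

/-- `g₀((T̂ - c) / β)`: the conditional probability of accepting the null hypothesis, given the
responses `y` and the critical value `c`. -/
def accept {n : ℕ} (y : Fin n → EuclideanSpace ℝ (Fin p)) (c : ℝ) : ℝ≥0∞ :=
  ENNReal.ofReal (t.g₀ ((t.That y - c) / t.β n))

/-- The plug-in test is uniformly consistent over the sets `𝒲 n` of models: the supremum of the
acceptance probabilities tends to zero (exact critical values). -/
def PIAConsistent (𝒲 : (n : ℕ) → Set (Model d p n)) : Prop :=
  ∀ c : (n : ℕ) → (Fin n → EuclideanSpace ℝ (Fin p)) → ℝ,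
    (∀ n y, t.IsCrit y (t.idx n) (1 - t.α) (c n y)) →
    Tendsto (fun n => ⨆ w ∈ 𝒲 n, ∫⁻ y, t.accept y (c n y) ∂(w.dataLaw t.X)) atTop (𝓝 0)

/-- The same for the refined moment selection; `cγ` is the preliminary plug-in critical value. -/
def RMSConsistent (𝒲 : (n : ℕ) → Set (Model d p n)) : Prop :=
  ∀ cγ c : (n : ℕ) → (Fin n → EuclideanSpace ℝ (Fin p)) → ℝ,
    (∀ n y, t.IsCrit y (t.idx n) (1 - t.γ n) (cγ n y)) →
    (∀ n y, t.IsCrit y (t.idxRMS y (cγ n y)) (1 - t.α + 2 * t.γ n) (c n y)) →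
    Tendsto (fun n => ⨆ w ∈ 𝒲 n, ∫⁻ y, t.accept y (c n y) ∂(w.dataLaw t.X)) atTop (𝓝 0)

/-- The same as `PIAConsistent` with critical values simulated from `B n` bootstrap samples. -/
def SimPIAConsistent (𝒲 : (n : ℕ) → Set (Model d p n)) : Prop :=
  ∀ c : (n : ℕ) → (Fin n → EuclideanSpace ℝ (Fin p)) →
      (Fin (t.B n) → Fin n → EuclideanSpace ℝ (Fin p)) → ℝ,
    (∀ n y z, t.IsSimCrit y (t.idx n) z (1 - t.α) (c n y z)) →
    Tendsto (fun n => ⨆ w ∈ 𝒲 n,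
      ∫⁻ y, ∫⁻ z, t.accept y (c n y z) ∂(t.simLaw y) ∂(w.dataLaw t.X)) atTop (𝓝 0)

/-- The same as `RMSConsistent` with simulated critical values; `z` are the bootstrap samples used
for the preliminary critical value `cγ` and `z'` the fresh ones used in the second step. -/
def SimRMSConsistent (𝒲 : (n : ℕ) → Set (Model d p n)) : Prop :=
  ∀ (cγ : (n : ℕ) → (Fin n → EuclideanSpace ℝ (Fin p)) →
      (Fin (t.B n) → Fin n → EuclideanSpace ℝ (Fin p)) → ℝ)
    (c : (n : ℕ) → (Fin n → EuclideanSpace ℝ (Fin p)) →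
      (Fin (t.B n) → Fin n → EuclideanSpace ℝ (Fin p)) →
      (Fin (t.B n) → Fin n → EuclideanSpace ℝ (Fin p)) → ℝ),
    (∀ n y z, t.IsSimCrit y (t.idx n) z (1 - t.γ n) (cγ n y z)) →
    (∀ n y z z', t.IsSimCrit y (t.idxRMS y (cγ n y z)) z' (1 - t.α + 2 * t.γ n) (c n y z z')) →
    Tendsto (fun n => ⨆ w ∈ 𝒲 n,
      ∫⁻ y, ∫⁻ z, ∫⁻ z', t.accept y (c n y z z') ∂(t.simLaw y) ∂(t.simLaw y) ∂(w.dataLaw t.X))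
      atTop (𝓝 0)

/-- Uniform consistency of the plug-in and of the refined moment selection test, with exact and
with simulated bootstrap critical values. -/
def UniformlyConsistent (𝒲 : (n : ℕ) → Set (Model d p n)) : Prop :=
  t.PIAConsistent 𝒲 ∧ t.RMSConsistent 𝒲 ∧ t.SimPIAConsistent 𝒲 ∧ t.SimRMSConsistent 𝒲

/-- The critical rate `(log n / n)^{1/(2ζ+d)}`. -/
def rate (_t : TestSetup d p) (ζ : ℝ) (n : ℕ) : ℝ :=
  (Real.log n / n) ^ (1 / (2 * ζ + d))

/-- `ϑ_n`. -/
def theta (ζ : ℝ) (n : ℕ) : ℝ :=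
  if ζ ≤ d then 4 * Real.sqrt d * t.hmin n else 4 * Real.sqrt d * t.rate ζ n

/-- The standing assumptions on the design, the bandwidths, the estimators of the covariance
matrices, the kernel, the test function and the test points. -/
structure Assumptions (c : ModelConstants) : Prop where
  /-- the design points are bounded; the largest bandwidth is the bound -/
  norm_X_lt : ∀ i, ‖t.X i‖ < t.hmax
  hmax_pos : 0 < t.hmax
  /-- the number of design points near each `X_i` is of the order of `n h ^ d`; at the sample
  points, the lower bound also holds for the half of the smallest bandwidth -/
  count_bounds : ∃ C₁ C₂ : ℝ, 0 < C₁ ∧ C₁ < C₂ ∧ ∀ᶠ n : ℕ in atTop,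
    (∀ i : ℕ, ∀ j ≤ t.k n, C₁ * n * t.bw j ^ d ≤ t.count n (t.bw j) i ∧
      (t.count n (t.bw j) i : ℝ) ≤ C₂ * n * t.bw j ^ d) ∧
    ∀ i < n, C₁ * n * (t.hmin n / 2) ^ d ≤ t.count n (t.hmin n / 2) i
  a_pos : 0 < t.a
  a_lt : t.a < 1
  hmin_tendsto : Tendsto t.hmin atTop (𝓝 0)
  card_bandwidths : ∃ C : ℝ, 0 < C ∧ ∀ᶠ n : ℕ in atTop, (t.k n + 1 : ℝ) ≤ C * Real.log n
  Sig_measurable : ∀ n i m₁ m₂, Measurable fun y => t.Sig n y i m₁ m₂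
  Sig_posSemidef : ∀ n y i, (t.Sig n y i).PosSemidef
  /-- `max_i ‖Σ̂_i - Σ_i‖ = o_p(n^{-κ})` with `κ = 1/(2+d) - φ`, in the spectral norm and uniformly
  over the class of models -/
  Sig_consistent : ∃ φ : ℝ, 0 < φ ∧ φ < 1 / (2 + d) ∧ ∀ η : ℝ, 0 < η →
    Tendsto (fun n : ℕ => ⨆ w ∈ {w : Model d p n | InModelClass c t.X w},
      w.dataLaw t.X {y | ∃ i : Fin n, η * (n : ℝ) ^ (-(1 / (2 + d) - φ)) <
        ‖Matrix.toEuclideanCLM (𝕜 := ℝ) (t.Sig n y i - w.cov i)‖}) atTop (𝓝 0)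
  K_nonneg : ∀ x, 0 ≤ t.K x
  K_support : ∀ x, 1 < ‖x‖ → t.K x = 0
  K_bounds : ∃ C : ℝ, 0 < C ∧ C < 1 ∧ (∀ x, t.K x ≤ 1) ∧ ∀ x, ‖x‖ ≤ 1 / 2 → C ≤ t.K x
  β_pos : ∀ n, 0 < t.β n
  β_le : ∃ C : ℝ, ∀ n, t.β n ≤ C
  β_rate : Tendsto (fun n : ℕ => Real.log n ^ 4 / (t.β n ^ 10 * t.hmin n ^ (3 * d) * n))
    atTop (𝓝 0)
  I_separated : ∀ n, ∀ j ≤ t.k n, ∀ i₁ ∈ t.I n j, ∀ i₂ ∈ t.I n j, i₁ ≠ i₂ →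
    2 * t.bw j < ‖t.X i₁ - t.X i₂‖
  I_covering : ∀ n, ∀ j ≤ t.k n, ∀ i : Fin n, ∃ i' ∈ t.I n j, ‖t.X i - t.X i'‖ ≤ 2 * t.bw j
  g₀_range : ∀ x, t.g₀ x ∈ Set.Icc (0 : ℝ) 1
  g₀_left : ∀ x ≤ 0, t.g₀ x = 1
  g₀_right : ∀ x, 1 ≤ x → t.g₀ x = 0
  g₀_diff : ∀ j < 3, Differentiable ℝ (iteratedDeriv j t.g₀)
  α_pos : 0 < t.α
  α_lt : t.α < 1
  /-- `γ_n` is positive and stays below `α / 2`, uniformly in `n` (it may be constant or vanish) -/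
  γ_pos : ∀ n, 0 < t.γ n
  γ_le : ∃ γmax : ℝ, γmax < t.α / 2 ∧ ∀ n, t.γ n ≤ γmax
  B_pos : ∀ n, 0 < t.B n

end TestSetup

end

noncomputable section

/-! ### One-sided bounds for functions in the smoothness classes -/

/-! Consistency needs only one test point at which signal beats noise, studentization and critical
value together. Write `h` for a bandwidth of the grid, `σ = √(n h ^ d)` and `ℓ = √(log n)`.

Signal. A function of the class may fall off quickly on one side of a point `x`, but on a suitable
half of the ball of radius `R` about `x` it stays above its value at `x` minus `D * R ^ ζ`
(`exists_halfspaceBound`). If `x` is a design point in the inner set, the ball of radius `4 h` about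
it is filled by the closure of the design, so some test point has its whole kernel support in that
half (`exists_test_point`). The weights are nonnegative and sum to one, so the smoothed regression
function there is at least `A / 2 - D * (8 h) ^ ζ`, with `A` the distance from the hypothesis
(`exists_signal`).

Noise. The test point depends on the model but not on the responses, so Chebyshev suffices: the
weights are `O(σ⁻²)`, and the noise exceeds `ℓ / σ` with probability `O(1 / log n)`. When the
covariance estimators are accurate, `V̂` is positive and `O(σ⁻¹)`.

Critical values. Given the responses, each studentized bootstrap sum is Gaussian with variance one
(or identically zero), so a union bound over all indices gives `√(6 log n)` as an upper bound,
whatever the estimated covariances and whatever subset of indices is selected. For exact critical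
values it holds for all large `n`; for simulated ones Markov's inequality gives it with probability
tending to one, for any number of draws.

Hence the test rejects with probability tending to one as soon as `(A / 2 - D * (8 h) ^ ζ) * σ / ℓ`
tends to infinity (`uniformlyConsistent_of_bandwidths`). For `ζ ≤ d` take the smallest bandwidth;
for `ζ > d` take one comparable with the critical rate, which balances `h ^ ζ` and `ℓ / σ`. -/

theorem abs_multilinear_apply_const_le {d k : ℕ}
    (M : ContinuousMultilinearMap ℝ (fun _ : Fin k => EuclideanSpace ℝ (Fin d)) ℝ) {B : ℝ}
    (hB : ∀ i : Fin k → Fin d, |M (fun j => EuclideanSpace.single (i j) (1 : ℝ))| ≤ B)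
    (v : EuclideanSpace ℝ (Fin d)) : |M (fun _ => v)| ≤ d ^ k * B * ‖v‖ ^ k := by
  have hv : v = ∑ i, v i • EuclideanSpace.single i (1 : ℝ) := by
    simpa using ((EuclideanSpace.basisFun (Fin d) ℝ).sum_repr v).symm
  have h1 : M (fun _ => v) = ∑ r : Fin k → Fin d,
      M (fun j => v (r j) • EuclideanSpace.single (r j) (1 : ℝ)) := by
    conv_lhs => rw [hv]
    exact M.map_sum (fun (_ : Fin k) (i : Fin d) => v i • EuclideanSpace.single i (1 : ℝ))
  rw [h1]
  refine (Finset.abs_sum_le_sum_abs _ _).trans ?_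
  have h2 : ∀ r ∈ (Finset.univ : Finset (Fin k → Fin d)),
      |M (fun j => v (r j) • EuclideanSpace.single (r j) (1 : ℝ))| ≤ B * ‖v‖ ^ k := by
    intro r _
    rw [M.map_smul_univ, smul_eq_mul, abs_mul, Finset.abs_prod, mul_comm]
    have h3 : ∏ j, |v (r j)| ≤ ‖v‖ ^ k := by
      refine (Finset.prod_le_prod (fun _ _ => abs_nonneg _)
        (fun j _ => (EuclideanSpace.norm_eq v ▸ ?_ : |v (r j)| ≤ ‖v‖))).trans (by simp)
      rw [← EuclideanSpace.norm_eq]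
      exact PiLp.norm_apply_le v (r j)
    exact mul_le_mul (hB r) h3 (Finset.prod_nonneg fun _ _ => abs_nonneg _)
      ((abs_nonneg _).trans (hB r))
  refine (Finset.sum_le_card_nsmul _ _ _ h2).trans (le_of_eq ?_)
  simp [mul_assoc]

theorem iteratedDeriv_comp_line {d k : ℕ} {g : EuclideanSpace ℝ (Fin d) → ℝ}
    (hg : ContDiff ℝ k g) (x v : EuclideanSpace ℝ (Fin d)) (t : ℝ) :
    iteratedDeriv k (fun t : ℝ => g (x + t • v)) t
      = iteratedFDeriv ℝ k g (x + t • v) (fun _ => v) := by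
  have h1 : (fun t : ℝ => g (x + t • v))
      = (fun y => g (x + y)) ∘ (ContinuousLinearMap.toSpanSingleton ℝ v) := by
    ext t; simp
  have h2 : ContDiff ℝ k (fun y => g (x + y)) := by fun_prop
  rw [iteratedDeriv_eq_iteratedFDeriv, h1,
    ContinuousLinearMap.iteratedFDeriv_comp_right _ h2 _ le_rfl, iteratedFDeriv_comp_add_left]
  simp

/-- Homogeneity of degree `k` in the direction transfers the conditions of the class, made for unit
directions only, to arbitrary segments. -/
theorem iteratedDeriv_line_smul {d k : ℕ} {g : EuclideanSpace ℝ (Fin d) → ℝ}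
    (hg : ContDiff ℝ k g) (x l : EuclideanSpace ℝ (Fin d)) (r : ℝ) :
    iteratedDeriv k (fun t : ℝ => g (x + t • (r • l))) 0 = r ^ k * dirDeriv k l g x := by
  rw [dirDeriv, iteratedDeriv_comp_line hg, iteratedDeriv_comp_line hg]
  simp only [zero_smul, add_zero]
  rw [← smul_eq_mul]
  simpa using (iteratedFDeriv ℝ k g x).map_smul_univ (fun _ => r) (fun _ => l)

/-- A Taylor estimate by repeated use of the mean value inequality, from order `s` down to order
`0`. On the unit interval no step enlarges the bound, so factorials are not needed. -/
theorem abs_sub_le_of_iteratedDeriv_eq_zero {s : ℕ} (hs : 1 ≤ s) {φ : ℝ → ℝ}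
    (hφ : ContDiff ℝ s φ) (h0 : ∀ k, 1 ≤ k → k ≤ s → iteratedDeriv k φ 0 = 0) {B : ℝ}
    (hB : ∀ t ∈ Set.Icc (0 : ℝ) 1, |iteratedDeriv s φ t| ≤ B) : |φ 1 - φ 0| ≤ B := by
  have step : ∀ k, k < s → (∀ t ∈ Set.Icc (0 : ℝ) 1, |iteratedDeriv (k + 1) φ t| ≤ B) →
      ∀ t ∈ Set.Icc (0 : ℝ) 1, |iteratedDeriv k φ t - iteratedDeriv k φ 0| ≤ B := by
    intro k hk h t ht
    have hd : Differentiable ℝ (iteratedDeriv k φ) :=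
      hφ.differentiable_iteratedDeriv k (by exact_mod_cast hk)
    have := Convex.norm_image_sub_le_of_norm_deriv_le (f := iteratedDeriv k φ)
      (s := Set.Icc (0 : ℝ) 1) (C := B) (x := 0) (y := t) (fun x _ => hd x)
      (fun x hx => by rw [← iteratedDeriv_succ]; exact h x hx) (convex_Icc 0 1) (by simp) ht
    have hB0 : 0 ≤ B := (abs_nonneg _).trans (h 0 (by simp))
    simp only [Real.norm_eq_abs, sub_zero, abs_of_nonneg ht.1] at this
    exact this.trans (mul_le_of_le_one_right hB0 ht.2)
  have key : ∀ j, j < s → ∀ t ∈ Set.Icc (0 : ℝ) 1, |iteratedDeriv (s - j) φ t| ≤ B := by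
    intro j
    induction j with
    | zero => intro _; simpa using hB
    | succ j ih =>
      intro hj t ht
      have h1 := step (s - (j + 1)) (by omega)
        (by rw [show s - (j + 1) + 1 = s - j by omega]; exact ih (by omega)) t ht
      rwa [h0 _ (by omega) (by omega), sub_zero] at h1
  have h1 := key (s - 1) (by omega)
  rw [show s - (s - 1) = 0 + 1 by omega] at h1
  have := step 0 hs h1 1 (by simp)
  simpa using this

theorem le_of_deriv_ge {φ : ℝ → ℝ} (hφ : Differentiable ℝ φ) {B : ℝ}
    (hB : ∀ t ∈ Set.Icc (0 : ℝ) 1, -B ≤ deriv φ t) : φ 0 - B ≤ φ 1 := by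
  have := Convex.mul_sub_le_image_sub_of_le_deriv (convex_Icc (0 : ℝ) 1)
    hφ.continuous.continuousOn hφ.differentiableOn (C := -B)
    (fun x hx => hB x (interior_subset hx)) 0 (by simp) 1 (by simp) zero_le_one
  linarith

/-- The regularity along lines that the smoothness classes provide. -/
theorem abs_iteratedDeriv_line_sub_le {d : ℕ} {c : ModelConstants} (hc : c.Valid) (hτ : 1 < c.τ)
    {g : EuclideanSpace ℝ (Fin d) → ℝ} (hg : g ∈ HolderClass d c.τ c.L)
    (hreg : c.ς < intBelow c.τ → ∀ (i : Fin (c.ς + 1) → Fin d) x, |partialDeriv i g x| ≤ c.Creg)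
    (x v : EuclideanSpace ℝ (Fin d)) {t : ℝ} (ht : t ∈ Set.Icc (0 : ℝ) 1) :
    |iteratedDeriv c.ς (fun t : ℝ => g (x + t • v)) t
        - iteratedDeriv c.ς (fun t : ℝ => g (x + t • v)) 0|
      ≤ (d ^ c.ς * c.L + d ^ (c.ς + 1) * c.Creg) * ‖v‖ ^ c.ζ := by
  obtain ⟨hcd, hhol⟩ := hg
  have hςN : c.ς ≤ intBelow c.τ := by
    rcases hc.ς_range with h | h
    · linarith [h.1]
    · exact h.2.2
  have hτN : (intBelow c.τ : ℝ) < c.τ ∧ c.τ ≤ intBelow c.τ + 1 := by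
    have h1 : 1 ≤ ⌈c.τ⌉₊ := Nat.one_le_ceil_iff.mpr (by linarith)
    have h2 : ((⌈c.τ⌉₊ - 1 : ℕ) : ℝ) = (⌈c.τ⌉₊ : ℝ) - 1 := by push_cast [h1]; ring
    have h3 := Nat.ceil_lt_add_one (show 0 ≤ c.τ by linarith)
    have h4 := Nat.le_ceil c.τ
    rw [intBelow, h2]; constructor <;> linarith
  have hgς : ContDiff ℝ c.ς g := hcd.of_le (by exact_mod_cast hςN)
  have hLpos := hc.L_pos
  have hCpos := hc.Creg_pos
  -- If `ς = [τ]`, the Hölder condition at the top order gives exponent `(τ - ς) + ς = τ = ζ`.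
  -- Otherwise the bound `Creg` on order `ς + 1` gives exponent `ς + 1 = ζ`.
  rcases hςN.eq_or_lt with h | h
  · have hζ : c.ζ = c.τ := by
      rw [ModelConstants.ζ, h]; exact min_eq_right hτN.2
    rw [iteratedDeriv_comp_line hgς, iteratedDeriv_comp_line hgς]
    have h1 := abs_multilinear_apply_const_le
      (iteratedFDeriv ℝ c.ς g (x + t • v) - iteratedFDeriv ℝ c.ς g (x + (0 : ℝ) • v))
      (B := c.L * ‖v‖ ^ (c.τ - c.ς)) (fun i => ?_) v
    · refine h1.trans ?_
      have : c.L * ‖v‖ ^ (c.τ - c.ς) * ‖v‖ ^ c.ς = c.L * ‖v‖ ^ c.ζ := by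
        rw [hζ, mul_assoc, ← Real.rpow_natCast ‖v‖, ← Real.rpow_add_of_nonneg (norm_nonneg v)]
        · congr 2; ring
        · rw [h]; linarith [hτN.1]
        · positivity
      rw [mul_assoc, this]
      have : 0 ≤ (d : ℝ) ^ (c.ς + 1) * c.Creg * ‖v‖ ^ c.ζ := by positivity
      nlinarith
    · have hh : ∀ (i : Fin c.ς → Fin d) (x y : EuclideanSpace ℝ (Fin d)),
          |partialDeriv i g x - partialDeriv i g y| ≤ c.L * ‖x - y‖ ^ (c.τ - c.ς) := by
        rw [h]; exact hhol
      refine (hh i (x + t • v) (x + (0 : ℝ) • v)).trans ?_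
      gcongr
      · rw [h]; linarith [hτN.1]
      · simp only [zero_smul, add_zero, add_sub_cancel_left, norm_smul, Real.norm_eq_abs,
          abs_of_nonneg ht.1]
        exact mul_le_of_le_one_left (norm_nonneg v) ht.2
  · have hζ : c.ζ = (c.ς + 1 : ℕ) := by
      have : (c.ς : ℝ) + 1 ≤ intBelow c.τ := by exact_mod_cast h
      rw [ModelConstants.ζ, min_eq_left (by linarith)]; simp
    have hgς' : ContDiff ℝ (c.ς + 1 : ℕ) g := hcd.of_le (by exact_mod_cast h)
    set φ := fun t : ℝ => g (x + t • v) with hφ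
    have hφ' : ContDiff ℝ (c.ς + 1 : ℕ) φ := by fun_prop
    have hd : Differentiable ℝ (iteratedDeriv c.ς φ) :=
      hφ'.differentiable_iteratedDeriv _ (by exact_mod_cast Nat.lt_succ_self _)
    have hb : ∀ s, |iteratedDeriv (c.ς + 1) φ s| ≤ d ^ (c.ς + 1) * c.Creg * ‖v‖ ^ (c.ς + 1) := by
      intro s
      rw [hφ, iteratedDeriv_comp_line hgς']
      exact abs_multilinear_apply_const_le _ (fun i => hreg h i _) v
    have := Convex.norm_image_sub_le_of_norm_deriv_le (f := iteratedDeriv c.ς φ)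
      (s := Set.univ) (x := 0) (y := t) (fun x _ => hd x)
      (fun s _ => by rw [← iteratedDeriv_succ]; exact hb s) convex_univ (by simp) (by simp)
    rw [hζ, Real.rpow_natCast]
    simp only [Real.norm_eq_abs, sub_zero, abs_of_nonneg ht.1] at this
    refine this.trans ((mul_le_of_le_one_right (by positivity) ht.2).trans ?_)
    gcongr
    have : 0 ≤ (d : ℝ) ^ c.ς * c.L := by positivity
    linarith

theorem hasDerivAt_line {d : ℕ} {g : EuclideanSpace ℝ (Fin d) → ℝ} (hg : Differentiable ℝ g)
    (x v : EuclideanSpace ℝ (Fin d)) (t : ℝ) :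
    HasDerivAt (fun t : ℝ => g (x + t • v)) (fderiv ℝ g (x + t • v) v) t := by
  have h1 : HasDerivAt (fun t : ℝ => x + t • v) v t := by
    simpa using ((hasDerivAt_id t).smul_const v).const_add x
  exact (hg _).hasFDerivAt.comp_hasDerivAt t h1

theorem hasDerivAt_fderiv_line {d : ℕ} {g : EuclideanSpace ℝ (Fin d) → ℝ} (hg : ContDiff ℝ 2 g)
    (x v : EuclideanSpace ℝ (Fin d)) (t : ℝ) :
    HasDerivAt (fun t : ℝ => fderiv ℝ g (x + t • v) v)
      (fderiv ℝ (fderiv ℝ g) (x + t • v) v v) t := by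
  have h1 : HasDerivAt (fun t : ℝ => x + t • v) v t := by
    simpa using ((hasDerivAt_id t).smul_const v).const_add x
  have h2 : Differentiable ℝ (fderiv ℝ g) :=
    (hg.fderiv_right (m := 1) (by norm_num)).differentiable (by norm_num)
  have h3 := (h2 _).hasFDerivAt.comp_hasDerivAt t h1
  exact h3.clm_apply (hasDerivAt_const t v) |>.congr_deriv (by simp)

theorem dirDeriv_one_eq {d : ℕ} {g : EuclideanSpace ℝ (Fin d) → ℝ} (hg : Differentiable ℝ g)
    (l x : EuclideanSpace ℝ (Fin d)) : dirDeriv 1 l g x = fderiv ℝ g x l := by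
  rw [dirDeriv, iteratedDeriv_one, (hasDerivAt_line hg x l 0).deriv]; simp

theorem dirDeriv_two_eq {d : ℕ} {g : EuclideanSpace ℝ (Fin d) → ℝ} (hg : ContDiff ℝ 2 g)
    (l x : EuclideanSpace ℝ (Fin d)) : dirDeriv 2 l g x = fderiv ℝ (fderiv ℝ g) x l l := by
  have h1 : Differentiable ℝ g := hg.differentiable (by norm_num)
  rw [dirDeriv, iteratedDeriv_succ, iteratedDeriv_one,
    show deriv (fun t : ℝ => g (x + t • l)) = fun t => fderiv ℝ g (x + t • l) l from
      funext fun t => (hasDerivAt_line h1 x l t).deriv, (hasDerivAt_fderiv_line hg x l 0).deriv]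
  simp

/-- If the second derivative vanishes on the kernel of the first one, then a directional derivative
cannot change its sign along a segment without critical points. -/
theorem fderiv_line_nonneg {d : ℕ} {g : EuclideanSpace ℝ (Fin d) → ℝ} (hg : ContDiff ℝ 2 g)
    (hflat : ∀ x l, fderiv ℝ g x l = 0 → fderiv ℝ (fderiv ℝ g) x l l = 0)
    (x v : EuclideanSpace ℝ (Fin d))
    (hne : ∀ t ∈ Set.Icc (0 : ℝ) 1, fderiv ℝ g (x + t • v) ≠ 0)
    (h0 : 0 ≤ fderiv ℝ g x v) {s : ℝ} (hs : s ∈ Set.Icc (0 : ℝ) 1) :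
    0 ≤ fderiv ℝ g (x + s • v) v := by
  set u : ℝ → ℝ := fun t => fderiv ℝ g (x + t • v) v with hu
  -- The gradient divided by its squared norm, so that the first derivative takes the value `1` on
  -- `e t`. Then `v - u t • e t` lies in the kernel of the first derivative.
  set e : ℝ → EuclideanSpace ℝ (Fin d) := fun t =>
    (‖fderiv ℝ g (x + t • v)‖ ^ 2)⁻¹ •
      (InnerProductSpace.toDual ℝ (EuclideanSpace ℝ (Fin d))).symm (fderiv ℝ g (x + t • v)) with he
  have hc1 : Continuous (fderiv ℝ g) := hg.continuous_fderiv (by norm_num)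
  have hc2 : Continuous (fderiv ℝ (fderiv ℝ g)) :=
    (hg.fderiv_right (m := 1) (by norm_num)).continuous_fderiv (by norm_num)
  have hline : Continuous fun t : ℝ => x + t • v := by fun_prop
  have huc : Continuous u := (hc1.comp hline).clm_apply continuous_const
  have hec : ContinuousOn e (Set.Icc 0 1) := by
    have hn : ContinuousOn (fun t : ℝ => (‖fderiv ℝ g (x + t • v)‖ ^ 2)⁻¹) (Set.Icc 0 1) :=
      ((hc1.comp hline).norm.pow 2).continuousOn.inv₀ fun t ht =>
        pow_ne_zero 2 (norm_ne_zero_iff.mpr (hne t ht))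
    exact hn.smul ((LinearIsometryEquiv.continuous _).comp (hc1.comp hline)).continuousOn
  have he1 : ∀ t ∈ Set.Icc (0 : ℝ) 1, fderiv ℝ g (x + t • v) (e t) = 1 := by
    intro t ht
    have h1 : ‖fderiv ℝ g (x + t • v)‖ ≠ 0 := norm_ne_zero_iff.mpr (hne t ht)
    rw [he]
    simp only [map_smul, smul_eq_mul]
    rw [← InnerProductSpace.toDual_symm_apply (𝕜 := ℝ), real_inner_self_eq_norm_sq,
      LinearIsometryEquiv.norm_map]
    field_simp
  -- Expand the second derivative at `(v, v)` along `v = (v - u e) + u e`. The term with `v - u e`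
  -- in both slots vanishes by `hflat`, and all others contain `u`; hence `u' = u * κ`.
  set κ : ℝ → ℝ := fun t => fderiv ℝ (fderiv ℝ g) (x + t • v) (v - u t • e t) (e t)
    + fderiv ℝ (fderiv ℝ g) (x + t • v) (e t) v with hκ
  have hκc : ContinuousOn κ (Set.Icc 0 1) := by
    have hD : ContinuousOn (fun t : ℝ => fderiv ℝ (fderiv ℝ g) (x + t • v)) (Set.Icc 0 1) :=
      (hc2.comp hline).continuousOn
    exact ((hD.clm_apply (continuousOn_const.sub (huc.continuousOn.smul hec))).clm_apply hec).add
      ((hD.clm_apply hec).clm_apply continuousOn_const)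
  have hode : ∀ t ∈ Set.Icc (0 : ℝ) 1, fderiv ℝ (fderiv ℝ g) (x + t • v) v v = u t * κ t := by
    intro t ht
    have h1 : fderiv ℝ g (x + t • v) (v - u t • e t) = 0 := by
      rw [map_sub, map_smul, he1 t ht]; simp [hu]
    have h2 := hflat _ _ h1
    simp only [map_sub, map_smul, sub_apply, smul_apply,
      smul_eq_mul, hκ] at h2 ⊢
    linear_combination h2
  obtain ⟨C, hC⟩ := isCompact_Icc.exists_bound_of_continuousOn hκc
  -- A negative value would force an earlier zero of `u`; by uniqueness for the linear equation `u'
  -- = u * κ`, `u` would vanish from there on.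
  by_contra! hneg
  obtain ⟨t₁, ht₁, hut₁⟩ := intermediate_value_Icc' hs.1 huc.continuousOn
    (show (0 : ℝ) ∈ Set.Icc (u s) (u 0) from ⟨hneg.le, by simpa [hu] using h0⟩)
  have := eq_zero_of_abs_deriv_le_mul_abs_self_of_eq_zero_right (f := u)
    (f' := fun t => fderiv ℝ (fderiv ℝ g) (x + t • v) v v) (K := C) (a := t₁) (b := 1)
    huc.continuousOn (fun t _ => (hasDerivAt_fderiv_line hg x v t).hasDerivWithinAt) hut₁
    (fun t ht => by
      have ht' : t ∈ Set.Icc (0 : ℝ) 1 := ⟨ht₁.1.trans ht.1, ht.2.le⟩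
      rw [hode t ht', norm_mul, mul_comm]
      exact mul_le_mul_of_nonneg_right (hC t ht') (norm_nonneg _)) s ⟨ht₁.2, hs.2⟩
  exact absurd this hneg.ne

/-- Every function of the class is bounded below, up to `D * R ^ ζ`, by its value at the centre of a
ball of radius `R` on a half of that ball. -/
def HalfspaceBound (d : ℕ) (c : ModelConstants) (D : ℝ) : Prop :=
  ∀ g ∈ HolderSubclass d c.ς c.τ c.L,
    (c.ς < intBelow c.τ → ∀ (i : Fin (c.ς + 1) → Fin d) x, |partialDeriv i g x| ≤ c.Creg) →
    ∀ (x : EuclideanSpace ℝ (Fin d)) (R : ℝ), 0 ≤ R → ∃ v : EuclideanSpace ℝ (Fin d),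
      ∀ y, ‖y - x‖ ≤ R → 0 ≤ inner ℝ v (y - x) → g x - D * R ^ c.ζ ≤ g y

/-- For `τ ≤ 1` this is the Hölder condition, on the whole ball. For `ς = 1`, a first-order
expansion in the half-space of the gradient suffices. For `ς ≥ 2` there are two cases. A critical
point in the ball makes `g` flat to order `ζ` around it, so again the whole ball works. Without one,
no directional derivative changes sign along a segment from `x`, and `g` does not fall below `g x`
in the half-space of the gradient. -/
theorem exists_halfspaceBound (d : ℕ) {c : ModelConstants} (hc : c.Valid) :
    ∃ D : ℝ, 0 < D ∧ HalfspaceBound d c D := by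
  have hL := hc.L_pos
  have hCr := hc.Creg_pos
  have hτ0 := hc.τ_ge
  have hζ0 : 0 ≤ c.ζ := le_min (by positivity) (by linarith)
  set A : ℝ := d ^ c.ς * c.L + d ^ (c.ς + 1) * c.Creg with hA
  have hA0 : 0 ≤ A := by positivity
  -- `L` serves the case `τ ≤ 1`. The term `2 * A * 2 ^ ζ` compares `g y` with `g x` through a
  -- critical point, at distance at most `2 R` from each.
  refine ⟨c.L + 2 * A * 2 ^ c.ζ, by positivity, fun g hg hreg x R hR => ?_⟩
  have hAR : A * R ^ c.ζ ≤ (c.L + 2 * A * 2 ^ c.ζ) * R ^ c.ζ := by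
    gcongr
    have : (1 : ℝ) ≤ 2 ^ c.ζ := Real.one_le_rpow (by norm_num) hζ0
    nlinarith
  rcases hc.ς_range with ⟨hτ, hς⟩ | ⟨hτ, hς1, hςN⟩
  · have hN : intBelow c.τ = 0 := by
      have : ⌈c.τ⌉₊ ≤ 1 := Nat.ceil_le.mpr (by simpa using hτ)
      rw [intBelow]; omega
    have hζ : c.ζ = c.τ := by rw [ModelConstants.ζ, hς]; exact min_eq_right (by simpa using hτ)
    refine ⟨0, fun y hy _ => ?_⟩
    have hh : |g x - g y| ≤ c.L * ‖x - y‖ ^ c.τ := by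
      have := hg.1.2
      rw [hN] at this
      simpa [partialDeriv] using this Fin.elim0 x y
    have h2 : c.L * ‖x - y‖ ^ c.τ ≤ (c.L + 2 * A * 2 ^ c.ζ) * R ^ c.ζ := by
      rw [hζ, norm_sub_rev]
      gcongr
      have : 0 ≤ 2 * A * 2 ^ c.τ := by positivity
      linarith
    linarith [le_abs_self (g x - g y)]
  · obtain ⟨hzero, -⟩ := hg.2 hτ
    have hgN : ContDiff ℝ (intBelow c.τ : ℕ) g := hg.1.1
    have hgς : ContDiff ℝ c.ς g := hgN.of_le (by exact_mod_cast hςN)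
    have hgd : Differentiable ℝ g := hgς.differentiable (by
      have : c.ς ≠ 0 := by omega
      exact_mod_cast this)
    have hline : ∀ z v : EuclideanSpace ℝ (Fin d),
        ContDiff ℝ c.ς (fun t : ℝ => g (z + t • v)) := fun z v => by fun_prop
    have hbd := fun z v t ht => abs_iteratedDeriv_line_sub_le (d := d) hc hτ hg.1 hreg z v (t := t) ht
    rcases hς1.eq_or_lt with h1 | h2
    · refine ⟨(InnerProductSpace.toDual ℝ _).symm (fderiv ℝ g x), fun y hy hv => ?_⟩
      rw [InnerProductSpace.toDual_symm_apply] at hv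
      have hder : ∀ t, iteratedDeriv c.ς (fun t : ℝ => g (x + t • (y - x))) t
          = fderiv ℝ g (x + t • (y - x)) (y - x) := fun t => by
        rw [← h1, iteratedDeriv_one, (hasDerivAt_line hgd x (y - x) t).deriv]
      have h3 : g x - A * ‖y - x‖ ^ c.ζ ≤ g y := by
        have := le_of_deriv_ge (φ := fun t : ℝ => g (x + t • (y - x))) (B := A * ‖y - x‖ ^ c.ζ)
          (fun t => (hasDerivAt_line hgd x (y - x) t).differentiableAt) (fun t ht => by
            have h4 := hbd x (y - x) t ht
            rw [hder, hder] at h4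
            rw [(hasDerivAt_line hgd x (y - x) t).deriv]
            have h5 := (abs_le.mp h4).1
            simp only [zero_smul, add_zero] at h5
            linarith)
        simpa using this
      have h6 : A * ‖y - x‖ ^ c.ζ ≤ A * R ^ c.ζ := by gcongr
      linarith
    · by_cases hcrit : ∃ z, ‖z - x‖ ≤ R ∧ fderiv ℝ g z = 0
      · obtain ⟨z, hzR, hz⟩ := hcrit
        have hz' : ∀ y, |g y - g z| ≤ A * ‖y - z‖ ^ c.ζ := by
          intro y
          have hvan : ∀ k, 1 ≤ k → k ≤ c.ς →
              iteratedDeriv k (fun t : ℝ => g (z + t • (y - z))) 0 = 0 := by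
            intro k hk1 hkς
            have hgk : ContDiff ℝ k g := hgς.of_le (by exact_mod_cast hkς)
            by_cases hyz : ‖y - z‖ = 0
            · have : y - z = 0 := norm_eq_zero.mp hyz
              simp only [this, smul_zero, add_zero]
              rw [iteratedDeriv_const]; simp; omega
            · have h3 := iteratedDeriv_line_smul hgk z (‖y - z‖⁻¹ • (y - z)) ‖y - z‖
              rw [smul_smul, mul_inv_cancel₀ hyz, one_smul] at h3
              rw [h3, hzero _ (by simp [norm_smul, hyz]) z
                (by rw [dirDeriv_one_eq hgd, hz]; simp) k hk1 hkς, mul_zero]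
          have := abs_sub_le_of_iteratedDeriv_eq_zero (by omega) (hline z (y - z)) hvan
            (B := A * ‖y - z‖ ^ c.ζ) (fun t ht => by
              have h3 := hbd z (y - z) t ht
              rwa [hvan _ (by omega) le_rfl, sub_zero] at h3)
          simpa using this
        refine ⟨0, fun y hy _ => ?_⟩
        have h3 := hz' y
        have h4 := hz' x
        have h5 : A * ‖y - z‖ ^ c.ζ ≤ A * (2 ^ c.ζ * R ^ c.ζ) := by
          rw [← Real.mul_rpow (by norm_num) hR]
          gcongr
          have := norm_sub_le_norm_sub_add_norm_sub y x z
          rw [norm_sub_rev x z] at this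
          linarith
        have h6 : A * ‖x - z‖ ^ c.ζ ≤ A * (2 ^ c.ζ * R ^ c.ζ) := by
          rw [← Real.mul_rpow (by norm_num) hR, norm_sub_rev]
          gcongr
          linarith
        have h7 : 0 ≤ c.L * R ^ c.ζ := by positivity
        have h8 := (abs_le.mp h3).1
        have h9 := (abs_le.mp h4).2
        nlinarith
      · push Not at hcrit
        have hg2 : ContDiff ℝ 2 g := hgς.of_le (by exact_mod_cast h2)
        have hflat : ∀ z l, fderiv ℝ g z l = 0 → fderiv ℝ (fderiv ℝ g) z l l = 0 := by
          intro z l hl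
          by_cases hl0 : ‖l‖ = 0
          · simp [norm_eq_zero.mp hl0]
          · have h3 := hzero (‖l‖⁻¹ • l) (by simp [norm_smul, hl0]) z
              (by rw [dirDeriv_one_eq hgd]; simp [hl]) 2 (by norm_num) h2
            rw [dirDeriv_two_eq hg2] at h3
            simpa [hl0] using h3
        refine ⟨(InnerProductSpace.toDual ℝ _).symm (fderiv ℝ g x), fun y hy hv => ?_⟩
        rw [InnerProductSpace.toDual_symm_apply] at hv
        have := le_of_deriv_ge (φ := fun t : ℝ => g (x + t • (y - x))) (B := 0)
          (fun t => (hasDerivAt_line hgd x (y - x) t).differentiableAt) (fun t ht => by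
            rw [(hasDerivAt_line hgd x (y - x) t).deriv, neg_zero]
            refine fderiv_line_nonneg hg2 hflat x (y - x) (fun s hs => hcrit _ ?_) hv ht
            rw [add_sub_cancel_left, norm_smul, Real.norm_eq_abs, abs_of_nonneg hs.1]
            exact (mul_le_of_le_one_left (norm_nonneg _) hs.2).trans hy)
        have h3 : 0 ≤ (c.L + 2 * A * 2 ^ c.ζ) * R ^ c.ζ := by positivity
        simp at this
        linarith

namespace TestSetup

variable {d p : ℕ} {t : TestSetup d p} {c : ModelConstants}

/-! ### Bandwidths, test points and weights -/

theorem Assumptions.bw_pos (ha : t.Assumptions c) (j : ℕ) : 0 < t.bw j :=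
  mul_pos ha.hmax_pos (pow_pos ha.a_pos j)

theorem Assumptions.hmin_pos (ha : t.Assumptions c) (n : ℕ) : 0 < t.hmin n := ha.bw_pos _

theorem Assumptions.bw_anti (ha : t.Assumptions c) {i j : ℕ} (h : i ≤ j) : t.bw j ≤ t.bw i :=
  mul_le_mul_of_nonneg_left (pow_le_pow_of_le_one ha.a_pos.le ha.a_lt.le h) ha.hmax_pos.le

theorem count_mono (n : ℕ) {h h' : ℝ} (hh : h ≤ h') (i : ℕ) : t.count n h i ≤ t.count n h' i :=
  Nat.card_mono (s := {j : Fin n | ‖t.X j - t.X i‖ ≤ h})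
    (t := {j : Fin n | ‖t.X j - t.X i‖ ≤ h'}) (Set.toFinite _) fun _ hj => le_trans hj hh

theorem exists_near_of_count_pos {n : ℕ} {h : ℝ} {i : ℕ} (hc : 0 < t.count n h i) :
    ∃ l : Fin n, ‖t.X l - t.X i‖ ≤ h := by
  obtain ⟨⟨l, hl⟩⟩ := (Nat.card_pos_iff.mp hc).1
  exact ⟨l, hl⟩

/-- The counts are controlled only at the bandwidths of the grid and at `hmin / 2`. Some grid
bandwidth a fixed number `q` of steps further lies below `bw j / 2`; if it is beyond the end of the
grid, `hmin / 2` takes its place. -/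
theorem Assumptions.exists_count_half_ge (ha : t.Assumptions c) :
    ∃ C : ℝ, 0 < C ∧ ∀ᶠ n : ℕ in atTop, ∀ j ≤ t.k n, ∀ i < n,
      C * (n * t.bw j ^ d) ≤ t.count n (t.bw j / 2) i := by
  obtain ⟨C₁, C₂, hC₁, -, hev⟩ := ha.count_bounds
  obtain ⟨q, hq⟩ := exists_pow_lt_of_lt_one (show (0 : ℝ) < 1 / 2 by norm_num) ha.a_lt
  have hap := ha.a_pos
  refine ⟨C₁ * (t.a ^ q / 2) ^ d, by positivity, hev.mono fun n hn j hj i hi => ?_⟩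
  have hb := ha.bw_pos j
  have hbq : t.bw (j + q) = t.bw j * t.a ^ q := by simp only [bw]; ring
  have hle : ∀ h : ℝ, t.bw j * t.a ^ q / 2 ≤ h →
      C₁ * (t.a ^ q / 2) ^ d * (n * t.bw j ^ d) ≤ C₁ * n * h ^ d := by
    intro h hh
    have : C₁ * (t.a ^ q / 2) ^ d * (n * t.bw j ^ d) = C₁ * n * (t.bw j * t.a ^ q / 2) ^ d := by
      rw [mul_div_assoc, mul_pow]; ring
    rw [this]
    gcongr
  rcases le_or_gt (j + q) (t.k n) with h | h
  · refine ((hle (t.bw (j + q)) ?_).trans (hn.1 i _ h).1).trans ?_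
    · have := ha.bw_pos (j + q)
      rw [← hbq]; linarith
    · exact_mod_cast count_mono n (by rw [hbq]; nlinarith) i
  · refine ((hle (t.hmin n / 2) ?_).trans (hn.2 i hi)).trans ?_
    · rw [← hbq]; have := ha.bw_anti h.le; rw [hmin]; linarith
    · exact_mod_cast count_mono n (by have := ha.bw_anti hj; rw [hmin]; linarith) i

theorem Assumptions.kern_nonneg (ha : t.Assumptions c) {h : ℝ} (hh : 0 ≤ h)
    (x : EuclideanSpace ℝ (Fin d)) : 0 ≤ t.kern h x :=
  div_nonneg (ha.K_nonneg _) (pow_nonneg hh d)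

theorem Assumptions.sum_kern_pos (ha : t.Assumptions c) {n : ℕ} {h : ℝ} (hh : 0 < h) (i : Fin n) :
    0 < ∑ l : Fin n, t.kern h (t.X i - t.X l) := by
  obtain ⟨C, hC, -, -, hK⟩ := ha.K_bounds
  refine Finset.sum_pos' (fun l _ => ha.kern_nonneg hh.le _) ⟨i, Finset.mem_univ _, ?_⟩
  rw [sub_self, kern, smul_zero]
  have := hK 0 (by simp)
  exact div_pos (by linarith) (pow_pos hh d)

theorem Assumptions.weight_nonneg (ha : t.Assumptions c) {n : ℕ} {h : ℝ} (hh : 0 < h)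
    (i l : Fin n) : 0 ≤ t.weight h i l :=
  div_nonneg (ha.kern_nonneg hh.le _) (ha.sum_kern_pos hh i).le

theorem Assumptions.sum_weight (ha : t.Assumptions c) {n : ℕ} {h : ℝ} (hh : 0 < h) (i : Fin n) :
    ∑ l, t.weight h i l = 1 := by
  simp only [weight, ← Finset.sum_div]
  exact div_self (ha.sum_kern_pos hh i).ne'

theorem Assumptions.weight_eq_zero (ha : t.Assumptions c) {n : ℕ} {h : ℝ} (hh : 0 < h)
    {i l : Fin n} (hil : h < ‖t.X l - t.X i‖) : t.weight h i l = 0 := by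
  have : t.kern h (t.X i - t.X l) = 0 := by
    rw [kern, ha.K_support, zero_div]
    rw [norm_smul, norm_inv, Real.norm_of_nonneg hh.le, norm_sub_rev, ← div_eq_inv_mul]
    exact (one_lt_div hh).mpr hil
  rw [weight, this, zero_div]

/-- The kernel is at most one, while the order of `n h ^ d` points within `h / 2` keep the
normalizing sum away from zero. -/
theorem Assumptions.exists_weight_le (ha : t.Assumptions c) :
    ∃ C : ℝ, 0 < C ∧ ∀ᶠ n : ℕ in atTop, ∀ j ≤ t.k n, ∀ i l : Fin n,
      t.weight (t.bw j) i l ≤ C / (n * t.bw j ^ d) := by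
  obtain ⟨C, hC, -, hK1, hK⟩ := ha.K_bounds
  obtain ⟨C', hC', hev⟩ := ha.exists_count_half_ge
  refine ⟨(C * C')⁻¹, by positivity, hev.mono fun n hn j hj i l => ?_⟩
  have hb := ha.bw_pos j
  have hn0 : (0 : ℝ) < n := by exact_mod_cast i.pos
  have hden : C * C' * n ≤ ∑ l : Fin n, t.kern (t.bw j) (t.X i - t.X l) := by
    classical
    have h1 : (t.count n (t.bw j / 2) i : ℝ) * (C / t.bw j ^ d)
        ≤ ∑ l : Fin n, t.kern (t.bw j) (t.X i - t.X l) := by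
      set F := Finset.univ.filter fun l : Fin n => ‖t.X l - t.X i‖ ≤ t.bw j / 2 with hF
      have hcard : t.count n (t.bw j / 2) i = F.card := by
        rw [count, Nat.card_eq_fintype_card, Fintype.card_subtype]
      rw [hcard, ← nsmul_eq_mul]
      have hsub : ∑ l ∈ F, t.kern (t.bw j) (t.X i - t.X l)
          ≤ ∑ l : Fin n, t.kern (t.bw j) (t.X i - t.X l) :=
        Finset.sum_le_sum_of_subset_of_nonneg (Finset.subset_univ _)
          fun l _ _ => ha.kern_nonneg hb.le _
      refine (Finset.card_nsmul_le_sum _ _ _ fun l hl => ?_).trans hsub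
      have hl' : ‖t.X l - t.X i‖ ≤ t.bw j / 2 := by simpa [hF] using hl
      rw [kern]
      gcongr
      apply hK
      rw [norm_smul, norm_inv, Real.norm_of_nonneg hb.le, norm_sub_rev, ← div_eq_inv_mul,
        div_le_iff₀ hb]
      linarith
    refine le_trans ?_ h1
    have h2 := hn j hj i i.2
    calc C * C' * n = C' * (n * t.bw j ^ d) * (C / t.bw j ^ d) := by field_simp
      _ ≤ _ := by gcongr
  have h3 : t.kern (t.bw j) (t.X i - t.X l) ≤ 1 / t.bw j ^ d := by
    rw [kern]; gcongr; exact hK1 _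
  calc t.weight (t.bw j) i l ≤ (1 / t.bw j ^ d) / (C * C' * n) := by
        rw [weight]; gcongr
    _ = _ := by field_simp

theorem Assumptions.eventually_exists_near (ha : t.Assumptions c) :
    ∀ᶠ n : ℕ in atTop, ∀ j ≤ t.k n, ∀ i : ℕ, ∃ l : Fin n, ‖t.X l - t.X i‖ ≤ t.bw j := by
  obtain ⟨C₁, C₂, hC₁, -, hev⟩ := ha.count_bounds
  filter_upwards [hev, eventually_gt_atTop 0] with n hn hn0 j hj i
  refine exists_near_of_count_pos ?_
  have hb := ha.bw_pos j
  have : (0 : ℝ) < C₁ * n * t.bw j ^ d := by positivity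
  exact_mod_cast this.trans_le (hn.1 i j hj).1

/-- Some test point has the support of its kernel in any given half-space through `X i`. -/
theorem Assumptions.exists_test_point (ha : t.Assumptions c) {n j : ℕ} (hj : j ≤ t.k n)
    (hnear : ∀ i : ℕ, ∃ l : Fin n, ‖t.X l - t.X i‖ ≤ t.bw j) {ϑ : ℝ} (hϑ : 4 * t.bw j ≤ ϑ)
    {i : ℕ} (hi : t.X i ∈ innerSet t.X ϑ) (v : EuclideanSpace ℝ (Fin d)) :
    ∃ k ∈ t.I n j, ∀ l : Fin n, ‖t.X l - t.X k‖ ≤ t.bw j →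
      0 ≤ inner ℝ v (t.X l - t.X i) ∧ ‖t.X l - t.X i‖ ≤ 8 * t.bw j := by
  have hb := ha.bw_pos j
  set h := t.bw j with hh
  -- The geometry below places the support in the half-space only up to an error `2 * ε * ‖v‖`. As
  -- there are finitely many sample points, a small `ε` makes every negative inner product violate
  -- that bound.
  have h1 : ∀ l : Fin n, ∀ᶠ ε in 𝓝[>] (0 : ℝ),
      (inner ℝ v (t.X l - t.X i) < 0 → inner ℝ v (t.X l - t.X i) < -(2 * ε * ‖v‖)) := by
    intro l
    by_cases hl : inner ℝ v (t.X l - t.X i) < 0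
    · have : Tendsto (fun ε : ℝ => -(2 * ε * ‖v‖)) (𝓝[>] 0) (𝓝 (-(2 * 0 * ‖v‖))) :=
        (Continuous.tendsto (by fun_prop) 0).mono_left nhdsWithin_le_nhds
      simp only [mul_zero, zero_mul, neg_zero] at this
      exact (this.eventually (lt_mem_nhds hl)).mono fun _ h _ => h
    · exact Eventually.of_forall fun _ h => absurd h hl
  obtain ⟨ε, hε, hε0, hεh⟩ := ((eventually_all.mpr h1).and
    (Ioo_mem_nhdsGT hb)).exists
  set e : EuclideanSpace ℝ (Fin d) := ‖v‖⁻¹ • v with he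
  have he1 : ‖e‖ ≤ 1 := by
    rw [he, norm_smul, norm_inv, norm_norm]; exact inv_mul_le_one
  have hve : inner ℝ v e = ‖v‖ := by
    rw [he, inner_smul_right, real_inner_self_eq_norm_sq]
    by_cases hv : ‖v‖ = 0
    · simp [hv]
    · field_simp
  -- From `x` to a point of the kernel support: less than `ε` to a design point, `h` to a sample
  -- point, `2 h` to a test point, `h` within the support. The shift is just short of `4 h`, so that
  -- `x` stays in the open ball contained in the closure of the design.
  set x := t.X i + (4 * h - ε) • e with hx
  have hxi : ‖x - t.X i‖ ≤ 4 * h - ε := by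
    rw [hx, add_sub_cancel_left, norm_smul, Real.norm_of_nonneg (by linarith)]
    exact mul_le_of_le_one_right (by linarith) he1
  have hxS : x ∈ closure (Set.range t.X) :=
    hi.2 (by rw [Metric.mem_ball, dist_eq_norm]; linarith)
  obtain ⟨_, ⟨i', rfl⟩, hi'⟩ := Metric.mem_closure_iff.mp hxS ε hε0
  rw [dist_eq_norm, norm_sub_rev] at hi'
  obtain ⟨l', hl'⟩ := hnear i'
  obtain ⟨k, hk, hkl⟩ := ha.I_covering n j hj l'
  refine ⟨k, hk, fun l hl => ?_⟩
  have hlx : ‖t.X l - x‖ ≤ 4 * h + ε := by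
    have e1 : t.X l - x = (t.X l - t.X k) - (t.X l' - t.X k) + (t.X l' - t.X i') + (t.X i' - x) := by
      abel
    rw [e1]
    have e2 := norm_add_le ((t.X l - t.X k) - (t.X l' - t.X k) + (t.X l' - t.X i')) (t.X i' - x)
    have e3 := norm_add_le ((t.X l - t.X k) - (t.X l' - t.X k)) (t.X l' - t.X i')
    have e4 := norm_sub_le (t.X l - t.X k) (t.X l' - t.X k)
    linarith
  constructor
  · by_contra! hneg
    have h2 := hε l hneg
    have h3 : inner ℝ v (t.X l - t.X i) = inner ℝ v (t.X l - x) + (4 * h - ε) * ‖v‖ := by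
      rw [← hve, ← inner_smul_right, ← inner_add_right]
      congr 1
      rw [hx]; abel
    have h4 := (abs_le.mp (abs_real_inner_le_norm v (t.X l - x))).1
    have h5 : ‖v‖ * ‖t.X l - x‖ ≤ ‖v‖ * (4 * h + ε) := by gcongr
    nlinarith
  · have := norm_sub_le_norm_sub_add_norm_sub (t.X l) x (t.X i)
    linarith

/-! ### Bounds for the critical values -/

theorem _root_.hasSubgaussianMGF_of_map_eq_gaussianReal {Ω : Type*} {mΩ : MeasurableSpace Ω}
    {μ : Measure Ω} {Z : Ω → ℝ} {v : NNReal} (hZ : MeasurePreserving Z μ (gaussianReal 0 v)) :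
    HasSubgaussianMGF Z v μ := by
  rw [← HasSubgaussianMGF.id_map_iff hZ.measurable.aemeasurable, hZ.map_eq]
  refine ⟨fun r => integrable_exp_mul_gaussianReal r, fun r => ?_⟩
  rw [mgf_gaussianReal (μ := 0) (v := v) (by simp)]
  simp

@[fun_prop]
theorem measurable_smooth {n : ℕ} (s : Fin n × Fin p × ℕ) :
    Measurable fun z : Fin n → EuclideanSpace ℝ (Fin p) => t.smooth z s := by
  unfold smooth
  fun_prop

instance {n : ℕ} (y : Fin n → EuclideanSpace ℝ (Fin p)) : IsProbabilityMeasure (t.bootLaw y) := by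
  unfold bootLaw; infer_instance

instance {n : ℕ} (y : Fin n → EuclideanSpace ℝ (Fin p)) : IsProbabilityMeasure (t.simLaw y) := by
  unfold simLaw; infer_instance

/-- The smoothed bootstrap sample is a sum of independent centred Gaussians whose total variance is
exactly `V̂ ^ 2`, so the sub-Gaussian tail does not depend on the responses. -/
theorem Assumptions.bootLaw_real_le (ha : t.Assumptions c) {n : ℕ}
    (y : Fin n → EuclideanSpace ℝ (Fin p)) (s : Fin n × Fin p × ℕ) {b : ℝ} (hb : 0 ≤ b) :
    (t.bootLaw y).real {z | b < t.smooth z s / t.Vhat y s} ≤ Real.exp (-b ^ 2 / 2) := by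
  -- If `V̂ = 0`, the quotient is `0` by convention and cannot exceed `b ≥ 0`.
  rcases (show 0 ≤ t.Vhat y s from Real.sqrt_nonneg _).eq_or_lt with hV | hV
  · have : {z | b < t.smooth z s / t.Vhat y s} = ∅ := by
      ext z; simp [← hV, hb]
    rw [this]; simp [Real.exp_nonneg]
  · have hPSD := ha.Sig_posSemidef n y
    have hdiag : ∀ j, 0 ≤ t.Sig n y j s.2.1 s.2.1 := fun j => (hPSD j).diag_nonneg
    set w := t.weight (t.bw s.2.2) s.1 with hw
    have hind : iIndepFun (fun (j : Fin n) (z : Fin n → EuclideanSpace ℝ (Fin p)) =>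
        w j * z j s.2.1) (t.bootLaw y) :=
      iIndepFun_pi (μ := fun j => multivariateGaussian 0 (t.Sig n y j))
        (X := fun j e => w j * e s.2.1) fun j => Measurable.aemeasurable (by fun_prop)
    have hsub : ∀ j ∈ Finset.univ, HasSubgaussianMGF
        (fun (z : Fin n → EuclideanSpace ℝ (Fin p)) => w j * z j s.2.1)
        (⟨w j ^ 2, sq_nonneg _⟩ * (t.Sig n y j s.2.1 s.2.1).toNNReal) (t.bootLaw y) := by
      intro j _
      refine (hasSubgaussianMGF_of_map_eq_gaussianReal ?_).const_mul (w j)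
      have h1 := measurePreserving_eval (fun j => multivariateGaussian 0 (t.Sig n y j)) j
      have h2 := measurePreserving_eval_multivariateGaussian (μ := 0) (hPSD j) (i := s.2.1)
      exact h2.comp h1
    have h3 := HasSubgaussianMGF.measure_sum_ge_le_of_iIndepFun hind hsub
      (mul_nonneg hb hV.le)
    have hVsq : t.Vhat y s ^ 2 = ∑ j, w j ^ 2 * t.Sig n y j s.2.1 s.2.1 :=
      Real.sq_sqrt (Finset.sum_nonneg fun j _ => mul_nonneg (sq_nonneg _) (hdiag j))
    have hcoe : ((∑ j, (⟨w j ^ 2, sq_nonneg _⟩ * (t.Sig n y j s.2.1 s.2.1).toNNReal : NNReal) :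
        NNReal) : ℝ) = t.Vhat y s ^ 2 := by
      rw [hVsq]; push_cast
      exact Finset.sum_congr rfl fun j _ => 
        congrArg (w j ^ 2 * ·) (Real.coe_toNNReal _ (hdiag j))
    rw [hcoe] at h3
    have h4 : -(b * t.Vhat y s) ^ 2 / (2 * t.Vhat y s ^ 2) = -b ^ 2 / 2 := by field_simp
    rw [h4] at h3
    refine (measureReal_mono fun z hz => ?_).trans h3
    have hz' : b < t.smooth z s / t.Vhat y s := hz
    rw [lt_div_iff₀ hV] at hz'
    exact hz'.le

/-- The bootstrap samples for which some studentized smoother exceeds `b`. -/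
def exceed {n : ℕ} (t : TestSetup d p) (y : Fin n → EuclideanSpace ℝ (Fin p)) (b : ℝ) :
    Set (Fin n → EuclideanSpace ℝ (Fin p)) :=
  {z | ∃ s ∈ t.idx n, b < t.smooth z s / t.Vhat y s}

/-- The union bound for the probability of `exceed`. -/
def tailBound (t : TestSetup d p) (n : ℕ) (b : ℝ) : ℝ :=
  n * p * (t.k n + 1) * Real.exp (-b ^ 2 / 2)

theorem idx_subset (n : ℕ) : t.idx n ⊆ ((Finset.univ ×ˢ Finset.univ ×ˢ Finset.range (t.k n + 1) :
    Finset (Fin n × Fin p × ℕ)) : Set (Fin n × Fin p × ℕ)) := by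
  intro s hs
  have : s.2.2 < t.k n + 1 := Nat.lt_succ_of_le hs.1
  simpa using this

theorem idx_finite (n : ℕ) : (t.idx n).Finite := (Finset.finite_toSet _).subset (idx_subset n)

theorem measurableSet_exceed {n : ℕ} (y : Fin n → EuclideanSpace ℝ (Fin p)) (b : ℝ) :
    MeasurableSet (t.exceed y b) := by
  have : t.exceed y b = ⋃ s ∈ t.idx n, {z | b < t.smooth z s / t.Vhat y s} := by
    ext z; simp [exceed]
  rw [this]
  refine (idx_finite n).measurableSet_biUnion fun s _ => ?_
  exact measurableSet_lt measurable_const ((measurable_smooth s).div_const _)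

theorem Assumptions.bootLaw_exceed_le (ha : t.Assumptions c) {n : ℕ}
    (y : Fin n → EuclideanSpace ℝ (Fin p)) {b : ℝ} (hb : 0 ≤ b) :
    (t.bootLaw y).real (t.exceed y b) ≤ t.tailBound n b := by
  have hsub : t.exceed y b ⊆ ⋃ s ∈ (Finset.univ ×ˢ Finset.univ ×ˢ Finset.range (t.k n + 1) :
      Finset (Fin n × Fin p × ℕ)), {z | b < t.smooth z s / t.Vhat y s} := by
    rintro z ⟨s, hs, hz⟩
    exact Set.mem_biUnion (idx_subset n hs) hz
  refine (measureReal_mono hsub (measure_ne_top _ _)).trans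
    ((measureReal_biUnion_finset_le _ _).trans
      ((Finset.sum_le_card_nsmul _ _ _ fun s _ => ha.bootLaw_real_le y s hb).trans (le_of_eq ?_)))
  simp [tailBound, mul_assoc]

theorem mem_exceed_of_lt_maxStat {n : ℕ} {y z : Fin n → EuclideanSpace ℝ (Fin p)}
    {A : Set (Fin n × Fin p × ℕ)} (hA : A ⊆ t.idx n) {b : ℝ} (hb : 0 ≤ b)
    (h : b < t.maxStat y A z) : z ∈ t.exceed y b := by
  -- The moment selection may leave no index; a real supremum over the empty set is `0`.
  rcases isEmpty_or_nonempty A with hE | hE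
  · rw [maxStat, Real.iSup_of_isEmpty] at h; linarith
  · obtain ⟨s, hs⟩ := exists_lt_of_lt_ciSup h
    exact ⟨s, hA s.2, hs⟩

theorem Assumptions.one_sub_g₀_le (ha : t.Assumptions c) {n : ℕ}
    {y z : Fin n → EuclideanSpace ℝ (Fin p)} {A : Set (Fin n × Fin p × ℕ)} (hA : A ⊆ t.idx n)
    {b x : ℝ} (hb : 0 ≤ b) (hx : b < x) :
    1 - t.g₀ ((t.maxStat y A z - x) / t.β n) ≤ (t.exceed y b).indicator 1 z := by
  by_cases hz : z ∈ t.exceed y b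
  · simpa [hz] using (ha.g₀_range _).1
  · have h1 : t.maxStat y A z ≤ b := by
      by_contra! h; exact hz (mem_exceed_of_lt_maxStat hA hb h)
    rw [ha.g₀_left _ (div_nonpos_of_nonpos_of_nonneg (by linarith) (ha.β_pos n).le)]
    simp [hz]

/-- A critical value above `b` would make `1 - lvl` at most the probability of `exceed`. The bound
is uniform in `y` and in `A ⊆ idx`, hence covers both procedures. -/
theorem Assumptions.isCrit_le (ha : t.Assumptions c) {n : ℕ}
    {y : Fin n → EuclideanSpace ℝ (Fin p)} {A : Set (Fin n × Fin p × ℕ)} (hA : A ⊆ t.idx n)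
    {lvl b x : ℝ} (hb : 0 ≤ b) (hlvl : 0 < lvl) (htail : t.tailBound n b < 1 - lvl)
    (hx : t.IsCrit y A lvl x) : x ≤ b := by
  by_contra! hbx
  rw [IsCrit] at hx
  -- A nonintegrable function would have integral `0`, but the level is positive.
  have hint : Integrable (fun z => t.g₀ ((t.maxStat y A z - x) / t.β n)) (t.bootLaw y) := by
    by_contra h
    rw [integral_undef h] at hx
    exact hlvl.ne hx
  have h1 : 1 - lvl = ∫ z, (1 - t.g₀ ((t.maxStat y A z - x) / t.β n)) ∂(t.bootLaw y) := by
    rw [integral_sub (integrable_const _) hint, hx]; simp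
  have h2 : ∫ z, (1 - t.g₀ ((t.maxStat y A z - x) / t.β n)) ∂(t.bootLaw y)
      ≤ ∫ z, (t.exceed y b).indicator 1 z ∂(t.bootLaw y) :=
    integral_mono ((integrable_const _).sub hint)
      ((integrable_const (1 : ℝ)).indicator (measurableSet_exceed y b))
      fun z => ha.one_sub_g₀_le hA hb hbx
  rw [integral_indicator_one (measurableSet_exceed y b)] at h2
  linarith [ha.bootLaw_exceed_le y hb]

/-- The simulated samples of which at least the fraction `q` lies in `exceed`. -/
def simExceed {n : ℕ} (t : TestSetup d p) (y : Fin n → EuclideanSpace ℝ (Fin p)) (b q : ℝ) :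
    Set (Fin (t.B n) → Fin n → EuclideanSpace ℝ (Fin p)) :=
  {z | q * t.B n ≤ ∑ r, (t.exceed y b).indicator 1 (z r)}

theorem Assumptions.mem_simExceed (ha : t.Assumptions c) {n : ℕ}
    {y : Fin n → EuclideanSpace ℝ (Fin p)} {A : Set (Fin n × Fin p × ℕ)} (hA : A ⊆ t.idx n)
    {z : Fin (t.B n) → Fin n → EuclideanSpace ℝ (Fin p)} {lvl b x : ℝ} (hb : 0 ≤ b) (hbx : b < x)
    (hx : t.IsSimCrit y A z lvl x) : z ∈ t.simExceed y b (1 - lvl) := by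
  have hB : (0 : ℝ) < t.B n := by exact_mod_cast ha.B_pos n
  rw [IsSimCrit, div_eq_iff hB.ne'] at hx
  have h1 : ∑ r, (1 - t.g₀ ((t.maxStat y A (z r) - x) / t.β n))
      ≤ ∑ r, (t.exceed y b).indicator 1 (z r) :=
    Finset.sum_le_sum fun r _ => ha.one_sub_g₀_le hA hb hbx
  rw [Finset.sum_sub_distrib, hx] at h1
  simp only [Finset.sum_const, Finset.card_univ, Fintype.card_fin, nsmul_eq_mul, mul_one] at h1
  rw [simExceed, Set.mem_ofPred_eq]
  linarith

/-- Markov's inequality: the expected fraction of draws in `exceed` is its bootstrap probability,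
whatever the number of draws. -/
theorem Assumptions.simLaw_simExceed_le (ha : t.Assumptions c) {n : ℕ}
    (y : Fin n → EuclideanSpace ℝ (Fin p)) {b q : ℝ} (hb : 0 ≤ b) (hq : 0 < q) :
    t.simLaw y (t.simExceed y b q) ≤ ENNReal.ofReal (t.tailBound n b / q) := by
  have hB : (0 : ℝ) < t.B n := by exact_mod_cast ha.B_pos n
  have hmp : ∀ r : Fin (t.B n), MeasurePreserving (fun z => z r) (t.simLaw y) (t.bootLaw y) :=
    fun r => measurePreserving_eval (fun _ => t.bootLaw y) r
  have hint1 : Integrable ((t.exceed y b).indicator (1 : (Fin n → EuclideanSpace ℝ (Fin p)) → ℝ)) (t.bootLaw y) :=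
    (integrable_const (1 : ℝ)).indicator (measurableSet_exceed y b)
  have hint : ∀ r : Fin (t.B n), Integrable
      (fun z => (t.exceed y b).indicator (1 : (Fin n → EuclideanSpace ℝ (Fin p)) → ℝ) (z r)) (t.simLaw y) := fun r =>
    (hmp r).integrable_comp_of_integrable hint1
  have h1 : ∫ z, ∑ r, (t.exceed y b).indicator (1 : (Fin n → EuclideanSpace ℝ (Fin p)) → ℝ) (z r) ∂(t.simLaw y)
      = t.B n * (t.bootLaw y).real (t.exceed y b) := by
    rw [integral_finsetSum _ fun r _ => hint r]
    have : ∀ r : Fin (t.B n), ∫ z, (t.exceed y b).indicator (1 : (Fin n → EuclideanSpace ℝ (Fin p)) → ℝ) (z r) ∂(t.simLaw y)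
        = (t.bootLaw y).real (t.exceed y b) := by
      intro r
      rw [← integral_indicator_one (measurableSet_exceed y b), ← (hmp r).map_eq,
        integral_map (hmp r).measurable.aemeasurable]
      rw [(hmp r).map_eq]; exact hint1.aestronglyMeasurable
    simp [this]
  have h2 := mul_meas_ge_le_integral_of_nonneg (μ := t.simLaw y)
    (f := fun z => ∑ r, (t.exceed y b).indicator (1 : (Fin n → EuclideanSpace ℝ (Fin p)) → ℝ) (z r))
    (Eventually.of_forall fun z => Finset.sum_nonneg fun r _ =>
      Set.indicator_nonneg (fun _ _ => zero_le_one) _)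
    (integrable_finsetSum _ fun r _ => hint r) (q * t.B n)
  rw [h1] at h2
  have h3 : (t.simLaw y).real (t.simExceed y b q) ≤ t.tailBound n b / q := by
    rw [le_div_iff₀ hq]
    refine le_trans ?_ (ha.bootLaw_exceed_le y hb)
    have : t.B n * (q * (t.simLaw y).real (t.simExceed y b q))
        ≤ t.B n * (t.bootLaw y).real (t.exceed y b) := by
      rw [← mul_assoc, mul_comm (t.B n : ℝ) q]; exact h2
    have := le_of_mul_le_mul_left this hB
    linarith
  rw [← ofReal_measureReal (measure_ne_top _ _)]
  exact ENNReal.ofReal_le_ofReal h3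

/-! ### Reduction of consistency to the behaviour of the test statistic -/

theorem Assumptions.accept_le_one (ha : t.Assumptions c) {n : ℕ}
    (y : Fin n → EuclideanSpace ℝ (Fin p)) (x : ℝ) : t.accept y x ≤ 1 :=
  ENNReal.ofReal_le_one.mpr (ha.g₀_range _).2

theorem Assumptions.accept_le_indicator (ha : t.Assumptions c) {n : ℕ}
    (y : Fin n → EuclideanSpace ℝ (Fin p)) {b x : ℝ} (hx : x ≤ b) :
    t.accept y x ≤ {y | t.That y < b + t.β n}.indicator 1 y := by
  by_cases hy : t.That y < b + t.β n
  · simpa [Set.indicator, hy] using ha.accept_le_one y x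
  · have hβ := ha.β_pos n
    rw [accept, ha.g₀_right _ ((one_le_div hβ).mpr (by linarith))]
    simp

theorem Assumptions.lintegral_accept_le (ha : t.Assumptions c) {n : ℕ}
    (y : Fin n → EuclideanSpace ℝ (Fin p)) {b lvl : ℝ} (hb : 0 ≤ b) (hlvl : lvl < 1)
    {A : Set (Fin n × Fin p × ℕ)} (hA : A ⊆ t.idx n)
    {x : (Fin (t.B n) → Fin n → EuclideanSpace ℝ (Fin p)) → ℝ}
    (hx : ∀ z, t.IsSimCrit y A z lvl (x z)) :
    ∫⁻ z, t.accept y (x z) ∂(t.simLaw y)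
      ≤ {y | t.That y < b + t.β n}.indicator 1 y
        + ENNReal.ofReal (t.tailBound n b / (1 - lvl)) := by
  calc ∫⁻ z, t.accept y (x z) ∂(t.simLaw y)
      ≤ ∫⁻ z, ({y | t.That y < b + t.β n}.indicator 1 y
          + (t.simExceed y b (1 - lvl)).indicator (fun _ => 1) z) ∂(t.simLaw y) := by
        refine lintegral_mono fun z => ?_
        rcases le_or_gt (x z) b with h | h
        · exact (ha.accept_le_indicator y h).trans le_self_add
        · have := ha.mem_simExceed hA hb h (hx z)
          simp only [Set.indicator_of_mem this]
          exact (ha.accept_le_one y _).trans le_add_self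
    _ = {y | t.That y < b + t.β n}.indicator 1 y
          + ∫⁻ z, (t.simExceed y b (1 - lvl)).indicator (fun _ => 1) z ∂(t.simLaw y) := by
        rw [lintegral_add_left measurable_const]; simp
    _ ≤ _ := by
        gcongr
        refine (lintegral_indicator_const_le _ _).trans ?_
        rw [one_mul]
        exact ha.simLaw_simExceed_le y hb (by linarith)

theorem _root_.Model.isProbabilityMeasure_dataLaw {n : ℕ} (X : ℕ → EuclideanSpace ℝ (Fin d))
    (w : Model d p n) : IsProbabilityMeasure (w.dataLaw X) :=
  Measure.isProbabilityMeasure_map (Measurable.aemeasurable (by fun_prop))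

theorem idxRMS_subset {n : ℕ} (y : Fin n → EuclideanSpace ℝ (Fin p)) (x : ℝ) :
    t.idxRMS y x ⊆ t.idx n := fun _ hs => hs.1

/-- With critical values below `b n`, acceptance has positive probability only if `T̂ < b n + β n`.
Critical values enter only through upper bounds on lower integrals, so they need not be measurable.
For moment selection, `1 - lvl = α - 2 * γ n` stays above the positive constant `α - 2 * γ`. -/
theorem Assumptions.uniformlyConsistent_of_tendsto (ha : t.Assumptions c)
    {𝒲 : (n : ℕ) → Set (Model d p n)} {b : ℕ → ℝ} (hb : ∀ n, 0 ≤ b n)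
    (htail : Tendsto (fun n => t.tailBound n (b n)) atTop (𝓝 0))
    (hT : Tendsto (fun n => ⨆ w ∈ 𝒲 n, w.dataLaw t.X {y | t.That y < b n + t.β n}) atTop (𝓝 0)) :
    t.UniformlyConsistent 𝒲 := by
  obtain ⟨γ, hγ, hγn⟩ := ha.γ_le
  have hα := ha.α_pos
  have hα1 := ha.α_lt
  have hexact : ∀ (q : ℝ) (hq : 0 < q) (lvl : ℕ → ℝ) (hl : ∀ n, 0 < lvl n ∧ lvl n ≤ 1 - q)
      (A : (n : ℕ) → (Fin n → EuclideanSpace ℝ (Fin p)) → Set (Fin n × Fin p × ℕ))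
      (hA : ∀ n y, A n y ⊆ t.idx n) (x : (n : ℕ) → (Fin n → EuclideanSpace ℝ (Fin p)) → ℝ)
      (hx : ∀ n y, t.IsCrit y (A n y) (lvl n) (x n y)),
      Tendsto (fun n => ⨆ w ∈ 𝒲 n, ∫⁻ y, t.accept y (x n y) ∂(w.dataLaw t.X)) atTop (𝓝 0) := by
    intro q hq lvl hl A hA x hx
    refine tendsto_of_tendsto_of_tendsto_of_le_of_le' tendsto_const_nhds hT
      (Eventually.of_forall fun _ => zero_le) ?_
    filter_upwards [htail.eventually (gt_mem_nhds hq)] with n hn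
    refine iSup₂_mono fun w _ => ?_
    calc ∫⁻ y, t.accept y (x n y) ∂(w.dataLaw t.X)
        ≤ ∫⁻ y, {y | t.That y < b n + t.β n}.indicator (fun _ => 1) y ∂(w.dataLaw t.X) :=
          lintegral_mono fun y => ha.accept_le_indicator y
            (ha.isCrit_le (hA n y) (hb n) (hl n).1 (by linarith [(hl n).2]) (hx n y))
      _ ≤ _ := (lintegral_indicator_const_le _ _).trans (by rw [one_mul])
  have hsim : ∀ (q : ℝ) (hq : 0 < q) (J : (n : ℕ) → (Fin n → EuclideanSpace ℝ (Fin p)) → ℝ≥0∞)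
      (hJ : ∀ n y, J n y ≤ {y | t.That y < b n + t.β n}.indicator 1 y
        + ENNReal.ofReal (t.tailBound n (b n) / q)),
      Tendsto (fun n => ⨆ w ∈ 𝒲 n, ∫⁻ y, J n y ∂(w.dataLaw t.X)) atTop (𝓝 0) := by
    intro q hq J hJ
    have h1 : Tendsto (fun n => ENNReal.ofReal (t.tailBound n (b n) / q)) atTop (𝓝 0) := by
      simpa using ENNReal.tendsto_ofReal (htail.div_const q)
    refine tendsto_of_tendsto_of_tendsto_of_le_of_le tendsto_const_nhds
      (by simpa using hT.add h1) (fun _ => zero_le) fun n => iSup₂_le fun w hw => ?_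
    have := Model.isProbabilityMeasure_dataLaw t.X w
    calc ∫⁻ y, J n y ∂(w.dataLaw t.X)
        ≤ ∫⁻ y, ({y | t.That y < b n + t.β n}.indicator (fun _ => 1) y
            + ENNReal.ofReal (t.tailBound n (b n) / q)) ∂(w.dataLaw t.X) :=
          lintegral_mono fun y => hJ n y
      _ = ∫⁻ y, {y | t.That y < b n + t.β n}.indicator (fun _ => 1) y ∂(w.dataLaw t.X)
            + ENNReal.ofReal (t.tailBound n (b n) / q) := by
          rw [lintegral_add_right _ measurable_const]; simp
      _ ≤ _ := by
          refine add_le_add_left ((lintegral_indicator_const_le _ _).trans ?_) _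
          rw [one_mul]
          exact le_iSup₂ (f := fun (w : Model d p n) (_ : w ∈ 𝒲 n) =>
            w.dataLaw t.X {y | t.That y < b n + t.β n}) w hw
  have htb : ∀ n, 0 ≤ t.tailBound n (b n) := fun n => by unfold tailBound; positivity
  refine ⟨fun x hx => ?_, fun xγ x _ hx => ?_, fun x hx => ?_, fun xγ x _ hx => ?_⟩
  · exact hexact t.α hα (fun _ => 1 - t.α) (fun _ => ⟨by linarith, le_rfl⟩) (fun n _ => t.idx n)
      (fun _ _ => subset_rfl) x hx
  · refine hexact (t.α - 2 * γ) (by linarith) (fun n => 1 - t.α + 2 * t.γ n)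
      (fun n => ⟨by linarith [ha.γ_pos n], by linarith [hγn n]⟩) (fun n y => t.idxRMS y (xγ n y))
      (fun n y => idxRMS_subset _ _) x hx
  · refine hsim t.α hα _ fun n y => ?_
    have := ha.lintegral_accept_le y (hb n) (by linarith) subset_rfl (hx n y)
    rwa [sub_sub_cancel] at this
  · refine hsim (t.α - 2 * γ) (by linarith) _ fun n y => ?_
    have h1 : ∀ z, ∫⁻ z', t.accept y (x n y z z') ∂(t.simLaw y)
        ≤ {y | t.That y < b n + t.β n}.indicator 1 y
          + ENNReal.ofReal (t.tailBound n (b n) / (t.α - 2 * γ)) := by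
      intro z
      refine (ha.lintegral_accept_le y (hb n) (by linarith [hγn n]) (idxRMS_subset _ _)
        (hx n y z)).trans ?_
      exact add_le_add_right (ENNReal.ofReal_le_ofReal (div_le_div_of_nonneg_left (htb n)
        (by linarith) (by linarith [hγn n]))) _
    refine (lintegral_mono h1).trans (le_of_eq ?_)
    simp

/-! ### The disturbances and the studentization -/

theorem _root_.InModelClass.lintegral_sq_le {n : ℕ} (hc : c.Valid)
    {X : ℕ → EuclideanSpace ℝ (Fin d)}
    {w : Model d p n} (hw : InModelClass c X w) (i : Fin n) (m : Fin p) :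
    ∫⁻ e, ENNReal.ofReal (e m ^ 2) ∂(w.law i : Measure (EuclideanSpace ℝ (Fin p)))
      ≤ ENNReal.ofReal (1 + c.Cmom) := by
  have hδ := hc.δ_pos
  have hpt : ∀ x : ℝ, x ^ 2 ≤ 1 + |x| ^ (4 + c.δ) := by
    intro x
    rw [← sq_abs]
    have h0 := abs_nonneg x
    rcases le_total |x| 1 with h | h
    · have : 0 ≤ |x| ^ (4 + c.δ) := by positivity
      nlinarith
    · have : |x| ^ (2 : ℝ) ≤ |x| ^ (4 + c.δ) := Real.rpow_le_rpow_of_exponent_le h (by linarith)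
      rw [Real.rpow_two] at this
      linarith
  calc ∫⁻ e, ENNReal.ofReal (e m ^ 2) ∂(w.law i : Measure (EuclideanSpace ℝ (Fin p)))
      ≤ ∫⁻ e, (1 + ENNReal.ofReal (|e m| ^ (4 + c.δ)))
          ∂(w.law i : Measure (EuclideanSpace ℝ (Fin p))) := by
        refine lintegral_mono fun e => (ENNReal.ofReal_le_ofReal (hpt (e m))).trans ?_
        rw [ENNReal.ofReal_add zero_le_one (by positivity), ENNReal.ofReal_one]
    _ ≤ _ := by
        rw [lintegral_add_left measurable_const, ENNReal.ofReal_add zero_le_one hc.Cmom_pos.le]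
        simpa using hw.moment_le i m

theorem _root_.InModelClass.memLp_two {n : ℕ} (hc : c.Valid)
    {X : ℕ → EuclideanSpace ℝ (Fin d)}
    {w : Model d p n} (hw : InModelClass c X w) (i : Fin n) (m : Fin p) :
    MemLp (fun e : EuclideanSpace ℝ (Fin p) => e m) 2
      (w.law i : Measure (EuclideanSpace ℝ (Fin p))) := by
  rw [memLp_two_iff_integrable_sq (Measurable.aestronglyMeasurable (by fun_prop))]
  refine ⟨Measurable.aestronglyMeasurable (by fun_prop), ?_⟩
  rw [hasFiniteIntegral_iff_ofReal (Eventually.of_forall fun e => sq_nonneg _)]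
  exact (InModelClass.lintegral_sq_le hc hw i m).trans_lt ENNReal.ofReal_lt_top

theorem _root_.InModelClass.cov_le {n : ℕ} (hc : c.Valid)
    {X : ℕ → EuclideanSpace ℝ (Fin d)}
    {w : Model d p n} (hw : InModelClass c X w) (i : Fin n) (m : Fin p) :
    w.cov i m m ≤ 1 + c.Cmom := by
  have h1 : w.cov i m m = ∫ e, e m ^ 2 ∂(w.law i : Measure (EuclideanSpace ℝ (Fin p))) := by
    simp [Model.cov, sq]
  have h2 := InModelClass.lintegral_sq_le hc hw i m
  rw [← ofReal_integral_eq_lintegral_ofReal (InModelClass.memLp_two hc hw i m).integrable_sq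
    (Eventually.of_forall fun e => sq_nonneg _)] at h2
  rw [h1]
  exact (ENNReal.ofReal_le_ofReal_iff (by linarith [hc.Cmom_pos])).mp h2

theorem _root_.InModelClass.variance_le {n : ℕ} (hc : c.Valid)
    {X : ℕ → EuclideanSpace ℝ (Fin d)}
    {w : Model d p n} (hw : InModelClass c X w) (i : Fin n) (m : Fin p) :
    Var[fun e => e m; (w.law i : Measure (EuclideanSpace ℝ (Fin p)))] ≤ 1 + c.Cmom := by
  rw [variance_of_integral_eq_zero (Measurable.aemeasurable (by fun_prop)) (hw.mean_zero i m)]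
  have := InModelClass.cov_le hc hw i m
  simpa [Model.cov, sq] using this

/-- Chebyshev's inequality for independent disturbances. It is strong enough because it is applied
at a single test point. -/
theorem _root_.InModelClass.dataLaw_noise_le {n : ℕ} (hc : c.Valid)
    {X : ℕ → EuclideanSpace ℝ (Fin d)}
    {w : Model d p n} (hw : InModelClass c X w) (m : Fin p) (a : Fin n → ℝ) {δ : ℝ} (hδ : 0 < δ) :
    w.dataLaw X {y | δ ≤ |∑ l, a l * (y l m - w.f m (X l))|}
      ≤ ENNReal.ofReal ((1 + c.Cmom) * (∑ l, a l ^ 2) / δ ^ 2) := by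
  have hmeas : Measurable fun (e : Fin n → EuclideanSpace ℝ (Fin p)) (i : Fin n) =>
      (WithLp.toLp 2 fun m => w.f m (X i) + e i m : EuclideanSpace ℝ (Fin p)) := by fun_prop
  set μ := fun i => (w.law i : Measure (EuclideanSpace ℝ (Fin p))) with hμ
  rw [Model.dataLaw, Measure.map_apply hmeas (measurableSet_le measurable_const (by fun_prop))]
  have hLp : ∀ l, MemLp (fun e : EuclideanSpace ℝ (Fin p) => a l * e m) 2 (μ l) := fun l =>
    (InModelClass.memLp_two hc hw l m).const_mul (a l)
  have hLp' : ∀ l, MemLp (fun e : Fin n → EuclideanSpace ℝ (Fin p) => a l * e l m) 2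
      (Measure.pi μ) := fun l => (hLp l).comp_measurePreserving (measurePreserving_eval μ l)
  set Z : (Fin n → EuclideanSpace ℝ (Fin p)) → ℝ :=
    ∑ l, fun e : Fin n → EuclideanSpace ℝ (Fin p) => a l * e l m with hZ
  have hZLp : MemLp Z 2 (Measure.pi μ) := memLp_finsetSum' _ fun l _ => hLp' l
  have hmean : ∫ e, Z e ∂(Measure.pi μ) = 0 := by
    simp only [hZ, Finset.sum_apply]
    rw [integral_finsetSum _ fun l _ => (hLp' l).integrable (by norm_num)]
    refine Finset.sum_eq_zero fun l _ => ?_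
    have h1 : ∫ e : Fin n → EuclideanSpace ℝ (Fin p), a l * e l m ∂(Measure.pi μ)
        = ∫ e : EuclideanSpace ℝ (Fin p), a l * e m ∂(μ l) := by
      rw [← (measurePreserving_eval μ l).map_eq,
        integral_map (measurable_pi_apply l).aemeasurable]
      exact Measurable.aestronglyMeasurable (by fun_prop)
    rw [h1, integral_const_mul, hw.mean_zero, mul_zero]
  have hvar : Var[Z; Measure.pi μ] ≤ (1 + c.Cmom) * ∑ l, a l ^ 2 := by
    rw [hZ, variance_sum_pi (X := fun l (e : EuclideanSpace ℝ (Fin p)) => a l * e m) hLp,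
      Finset.mul_sum]
    refine Finset.sum_le_sum fun l _ => ?_
    rw [variance_const_mul, mul_comm]
    exact mul_le_mul_of_nonneg_right (InModelClass.variance_le hc hw l m) (sq_nonneg _)
  have := meas_ge_le_variance_div_sq hZLp hδ
  rw [hmean] at this
  refine le_trans (le_of_eq ?_) (this.trans (ENNReal.ofReal_le_ofReal (by gcongr)))
  congr 1
  ext e
  simp [hZ, Finset.sum_apply]

theorem _root_.abs_diag_le_norm_toEuclideanCLM (M : Matrix (Fin p) (Fin p) ℝ) (m : Fin p) :
    |M m m| ≤ ‖Matrix.toEuclideanCLM (𝕜 := ℝ) M‖ := by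
  have h1 : (Matrix.toEuclideanCLM (𝕜 := ℝ) M (EuclideanSpace.single m (1 : ℝ))) m = M m m := by
    rw [Matrix.ofLp_toEuclideanCLM]; simp
  rw [← h1, ← Real.norm_eq_abs]
  refine (PiLp.norm_apply_le _ m).trans ((ContinuousLinearMap.le_opNorm _ _).trans ?_)
  simp

/-- Estimation errors of at most `cvar / 2` leave the estimated variances positive and bounded. As
the weights sum to one, the sum of their squares is at most their maximum `W`. -/
theorem Assumptions.Vhat_bounds (ha : t.Assumptions c) (hc : c.Valid) {n : ℕ} {w : Model d p n}
    (hw : InModelClass c t.X w) {y : Fin n → EuclideanSpace ℝ (Fin p)}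
    (hy : ∀ i, ‖Matrix.toEuclideanCLM (𝕜 := ℝ) (t.Sig n y i - w.cov i)‖ ≤ c.cvar / 2)
    {j : ℕ} {W : ℝ} (hW : ∀ i l : Fin n, t.weight (t.bw j) i l ≤ W) (i : Fin n) (m : Fin p) :
    0 < t.Vhat y (i, m, j) ∧ t.Vhat y (i, m, j) ≤ √((1 + c.Cmom + c.cvar) * W) := by
  have hb := ha.bw_pos j
  have hcv := hc.cvar_pos
  have hCm := hc.Cmom_pos
  have hd : ∀ l, c.cvar / 2 ≤ t.Sig n y l m m ∧ t.Sig n y l m m ≤ 1 + c.Cmom + c.cvar := by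
    intro l
    have h1 := (abs_diag_le_norm_toEuclideanCLM (t.Sig n y l - w.cov l) m).trans (hy l)
    rw [Matrix.sub_apply, abs_le] at h1
    have h2 := hw.var_ge l m
    have h3 := InModelClass.cov_le hc hw l m
    constructor <;> linarith [h1.1, h1.2]
  have hsum := ha.sum_weight hb i
  have hnn := fun l => ha.weight_nonneg hb i l
  constructor
  · refine Real.sqrt_pos.mpr (Finset.sum_pos' (fun l _ => ?_) ?_)
    · exact mul_nonneg (sq_nonneg _) (by linarith [(hd l).1])
    · have : ∃ l ∈ Finset.univ, t.weight (t.bw j) i l ≠ 0 := by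
        refine Finset.exists_ne_zero_of_sum_ne_zero ?_
        rw [hsum]; exact one_ne_zero
      obtain ⟨l, hl, hl0⟩ := this
      exact ⟨l, hl, mul_pos (by positivity) (by linarith [(hd l).1])⟩
  · refine Real.sqrt_le_sqrt ?_
    calc ∑ l, t.weight (t.bw j) i l ^ 2 * t.Sig n y l m m
        ≤ ∑ l, t.weight (t.bw j) i l * ((1 + c.Cmom + c.cvar) * W) := by
          refine Finset.sum_le_sum fun l _ => ?_
          rw [sq, mul_assoc]
          refine mul_le_mul_of_nonneg_left ?_ (hnn l)
          rw [mul_comm]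
          exact mul_le_mul (hd l).2 (hW i l) (hnn l) (by positivity)
      _ = _ := by rw [← Finset.sum_mul, hsum, one_mul]

theorem div_Vhat_le_That {n : ℕ} (y : Fin n → EuclideanSpace ℝ (Fin p))
    {s : Fin n × Fin p × ℕ} (hs : s ∈ t.idx n) : t.smooth y s / t.Vhat y s ≤ t.That y := by
  have : Finite (t.idx n) := (idx_finite n).to_subtype
  exact le_ciSup (f := fun s : t.idx n => t.smooth y s / t.Vhat y s) (Set.finite_range _).bddAbove
    ⟨s, hs⟩

/-! ### The signal -/

/-- If some model is at a distance of at least `A` from the null hypothesis, then the smoothed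
regression function is large at some test point. -/
theorem Assumptions.exists_signal (ha : t.Assumptions c) {D : ℝ} (hD : HalfspaceBound d c D)
    {n j : ℕ} (hj : j ≤ t.k n)
    (hnear : ∀ i : ℕ, ∃ l : Fin n, ‖t.X l - t.X i‖ ≤ t.bw j) {ϑ : ℝ} (hϑ : 4 * t.bw j ≤ ϑ)
    {w : Model d p n} (hw : InModelClass c t.X w) {A : ℝ} (hA : 0 < A)
    (hdist : ENNReal.ofReal A ≤ w.dist t.X ϑ) :
    ∃ k ∈ t.I n j, ∃ m : Fin p,
      A / 2 - D * (8 * t.bw j) ^ c.ζ ≤ ∑ l, t.weight (t.bw j) k l * w.f m (t.X l) := by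
  have hb := ha.bw_pos j
  have h1 : ENNReal.ofReal (A / 2) < w.dist t.X ϑ :=
    ((ENNReal.ofReal_lt_ofReal_iff hA).mpr (by linarith)).trans_le hdist
  -- The supremum need not be attained; halving `A` makes the inequality strict and yields a design
  -- point and a component.
  simp only [Model.dist, lt_iSup_iff] at h1
  obtain ⟨i, hi, m, him⟩ := h1
  have hf := ENNReal.ofReal_lt_ofReal_iff'.mp him |>.1
  obtain ⟨v, hv⟩ := hD (w.f m) (hw.f_mem m) (fun h => hw.deriv_le h m) (t.X i) (8 * t.bw j)
    (by positivity)
  obtain ⟨k, hk, hkl⟩ := ha.exists_test_point hj hnear hϑ hi v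
  refine ⟨k, hk, m, ?_⟩
  rw [← one_mul (A / 2 - D * (8 * t.bw j) ^ c.ζ), ← ha.sum_weight hb k, Finset.sum_mul]
  refine Finset.sum_le_sum fun l _ => ?_
  by_cases hl : ‖t.X l - t.X k‖ ≤ t.bw j
  · have h2 := hv (t.X l) (hkl l hl).2 (hkl l hl).1
    exact mul_le_mul_of_nonneg_left (by linarith) (ha.weight_nonneg hb k l)
  · rw [ha.weight_eq_zero hb (not_le.mp hl)]; simp

/-! ### Consistency along a sequence of bandwidths -/

theorem Assumptions.tendsto_tailBound (ha : t.Assumptions c) :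
    Tendsto (fun n : ℕ => t.tailBound n √(6 * Real.log n)) atTop (𝓝 0) := by
  obtain ⟨C, hC, hev⟩ := ha.card_bandwidths
  have h0 : Tendsto (fun n : ℕ => (p : ℝ) * C * (n : ℝ)⁻¹) atTop (𝓝 0) := by
    simpa using (tendsto_inv_atTop_nhds_zero_nat (𝕜 := ℝ)).const_mul ((p : ℝ) * C)
  refine tendsto_of_tendsto_of_tendsto_of_le_of_le' tendsto_const_nhds h0
    (Eventually.of_forall fun n => by unfold tailBound; positivity) ?_
  filter_upwards [hev, eventually_ge_atTop 1] with n hn hn1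
  have hn0 : (0 : ℝ) < n := by exact_mod_cast hn1
  have hlog : 0 ≤ Real.log n := Real.log_natCast_nonneg n
  -- The constant `6` gives the factor `n ^ (-3)`, against at most `n * p * (C * n)` terms in the
  -- union bound.
  have hexp : Real.exp (-√(6 * Real.log n) ^ 2 / 2) = ((n : ℝ) ^ 3)⁻¹ := by
    rw [Real.sq_sqrt (by positivity), show -(6 * Real.log n) / 2 = -(3 * Real.log n) by ring,
      Real.exp_neg, ← Real.rpow_natCast, Real.rpow_def_of_pos hn0]
    congr 2; push_cast; ring
  have hlogn : Real.log n ≤ n := (Real.log_le_sub_one_of_pos hn0).trans (by linarith)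
  rw [tailBound, hexp]
  calc (n : ℝ) * p * (t.k n + 1) * ((n : ℝ) ^ 3)⁻¹
      ≤ n * p * (C * n) * ((n : ℝ) ^ 3)⁻¹ := by
        gcongr; exact hn.trans (by gcongr)
    _ = _ := by field_simp

theorem Assumptions.uniformlyConsistent_of_bandwidths (ha : t.Assumptions c) (hc : c.Valid)
    {D : ℝ} (hD : HalfspaceBound d c D) {ϑ A : ℕ → ℝ} {j : ℕ → ℕ}
    (hj : ∀ᶠ n in atTop, j n ≤ t.k n) (hϑ : ∀ᶠ n in atTop, 4 * t.bw (j n) ≤ ϑ n)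
    (hA : ∀ᶠ n in atTop, 0 < A n)
    (hsig : Tendsto (fun n : ℕ => (A n / 2 - D * (8 * t.bw (j n)) ^ c.ζ)
      * (√(n * t.bw (j n) ^ d) / √(Real.log n))) atTop atTop) :
    t.UniformlyConsistent fun n =>
      {w | InModelClass c t.X w ∧ ENNReal.ofReal (A n) ≤ w.dist t.X (ϑ n)} := by
  refine ha.uniformlyConsistent_of_tendsto (b := fun n => √(6 * Real.log n))
    (fun n => Real.sqrt_nonneg _) ha.tendsto_tailBound ?_
  obtain ⟨Cw, hCw, hweight⟩ := ha.exists_weight_le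
  obtain ⟨Cβ, hβ⟩ := ha.β_le
  have hCβ : 0 < Cβ := (ha.β_pos 0).trans_le (hβ 0)
  obtain ⟨φ, -, hφ, hcons⟩ := ha.Sig_consistent
  have hcv := hc.cvar_pos
  have hCm := hc.Cmom_pos
  have hlog : Tendsto (fun n : ℕ => Real.log n) atTop atTop :=
    Real.tendsto_log_atTop.comp tendsto_natCast_atTop_atTop
  have hnoise : Tendsto (fun n : ℕ => ENNReal.ofReal ((1 + c.Cmom) * Cw / Real.log n)) atTop
      (𝓝 0) := by
    simpa using ENNReal.tendsto_ofReal (hlog.const_div_atTop ((1 + c.Cmom) * Cw))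
  have hsum := hnoise.add (hcons (c.cvar / 2) (by positivity))
  rw [add_zero] at hsum
  refine tendsto_of_tendsto_of_tendsto_of_le_of_le' tendsto_const_nhds hsum
    (Eventually.of_forall fun _ => zero_le) ?_
  set V : ℝ := √((1 + c.Cmom + c.cvar) * Cw) with hV
  have hV0 : 0 ≤ V := Real.sqrt_nonneg _
  -- In units of `ℓ / σ`, the threshold `1 + V * (√6 + Cβ)` pays `1` for the noise and the rest for
  -- `V̂ ≤ V / σ` times the critical value plus `β n`.
  filter_upwards [hj, hϑ, hA, hweight, ha.eventually_exists_near, eventually_ge_atTop 1,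
    hlog.eventually_ge_atTop 1,
    hsig.eventually_ge_atTop (1 + V * (√6 + Cβ))] with n hj hϑ hA hweight hnear hn1 hlog1 hsig
  refine iSup₂_le fun w hw => ?_
  obtain ⟨hw, hdist⟩ := hw
  obtain ⟨k, hk, m, hkm⟩ := ha.exists_signal hD hj (hnear _ hj) hϑ hw hA hdist
  have hn0 : (0 : ℝ) < n := by exact_mod_cast hn1
  have hb := ha.bw_pos (j n)
  set h := t.bw (j n) with hh
  set σ := √(n * h ^ d) with hσ
  set ℓ := √(Real.log n) with hℓ
  have hσ0 : 0 < σ := Real.sqrt_pos.mpr (by positivity)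
  have hσ2 : σ ^ 2 = n * h ^ d := Real.sq_sqrt (by positivity)
  have hℓ1 : 1 ≤ ℓ := Real.one_le_sqrt.mpr hlog1
  have hℓ2 : ℓ ^ 2 = Real.log n := Real.sq_sqrt (by linarith)
  have hδ : 0 < ℓ / σ := by positivity
  have hwt := hweight _ hj
  rw [← hh, ← hσ2] at hwt
  have hwnn := fun l => ha.weight_nonneg hb k l
  have hwsum := ha.sum_weight hb k
  have hsq : ∑ l, t.weight h k l ^ 2 ≤ Cw / σ ^ 2 := by
    calc ∑ l, t.weight h k l ^ 2 ≤ ∑ l, t.weight h k l * (Cw / σ ^ 2) :=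
          Finset.sum_le_sum fun l _ => by
            rw [sq]; exact mul_le_mul_of_nonneg_left (hwt k l) (hwnn l)
      _ = _ := by rw [← Finset.sum_mul, hwsum, one_mul]
  have hsub : {y : Fin n → EuclideanSpace ℝ (Fin p) | t.That y < √(6 * Real.log n) + t.β n}
      ⊆ {y | ℓ / σ ≤ |∑ l, t.weight h k l * (y l m - w.f m (t.X l))|}
        ∪ {y | ∃ i : Fin n, c.cvar / 2 * (n : ℝ) ^ (-(1 / (2 + d) - φ) : ℝ) <
          ‖Matrix.toEuclideanCLM (𝕜 := ℝ) (t.Sig n y i - w.cov i)‖} := by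
    intro y hy
    by_contra hnot
    rw [Set.mem_union, not_or] at hnot
    obtain ⟨hy1, hy2⟩ := hnot
    have hy1' : |∑ l, t.weight h k l * (y l m - w.f m (t.X l))| < ℓ / σ := not_le.mp hy1
    have hy2' : ∀ i, ‖Matrix.toEuclideanCLM (𝕜 := ℝ) (t.Sig n y i - w.cov i)‖ ≤ c.cvar / 2 := by
      intro i
      by_contra! hi
      refine hy2 ⟨i, lt_of_le_of_lt ?_ hi⟩
      refine mul_le_of_le_one_right (by positivity) ?_
      exact Real.rpow_le_one_of_one_le_of_nonpos (by exact_mod_cast hn1) (by linarith)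
    obtain ⟨hV1, hV2⟩ := ha.Vhat_bounds hc hw hy2' (j := j n) hwt k m
    have hV3 : √((1 + c.Cmom + c.cvar) * (Cw / σ ^ 2)) = V / σ := by
      rw [← mul_div_assoc, Real.sqrt_div' _ (by positivity), Real.sqrt_sq hσ0.le]
    rw [hV3] at hV2
    have hT := div_Vhat_le_That y (t := t) (s := (k, m, j n)) ⟨hj, hk⟩
    have hy' : t.That y < √(6 * Real.log n) + t.β n := hy
    have hsm : t.smooth y (k, m, j n) = ∑ l, t.weight h k l * w.f m (t.X l)
        + ∑ l, t.weight h k l * (y l m - w.f m (t.X l)) := by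
      rw [smooth, ← Finset.sum_add_distrib]
      exact Finset.sum_congr rfl fun l _ => by ring
    have hsig' : (1 + V * (√6 + Cβ)) * ℓ
        ≤ (A n / 2 - D * (8 * h) ^ c.ζ) * σ := by
      have : (A n / 2 - D * (8 * h) ^ c.ζ) * σ
          = (A n / 2 - D * (8 * h) ^ c.ζ) * (σ / ℓ) * ℓ := by field_simp
      rw [this]; gcongr
    have hlow : V / σ * ((√6 + Cβ) * ℓ) ≤ t.smooth y (k, m, j n) := by
      have h1 : (1 + V * (√6 + Cβ)) * ℓ / σ ≤ A n / 2 - D * (8 * h) ^ c.ζ :=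
        (div_le_iff₀ hσ0).mpr hsig'
      have h2 : (1 + V * (√6 + Cβ)) * ℓ / σ = ℓ / σ + V / σ * ((√6 + Cβ) * ℓ) := by ring
      have h3 := (abs_lt.mp hy1').1
      rw [hsm]; linarith
    have hcrit : √(6 * Real.log n) + t.β n ≤ (√6 + Cβ) * ℓ := by
      rw [Real.sqrt_mul (by norm_num)]
      have := hβ n
      nlinarith
    have hfin : (√6 + Cβ) * ℓ ≤ t.smooth y (k, m, j n) / t.Vhat y (k, m, j n) := by
      rw [le_div_iff₀ hV1, mul_comm]
      exact (mul_le_mul_of_nonneg_right hV2 (by positivity)).trans hlow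
    linarith
  refine (measure_mono hsub).trans ((measure_union_le _ _).trans (add_le_add ?_ ?_))
  · refine (InModelClass.dataLaw_noise_le hc hw m (t.weight h k) hδ).trans
      (ENNReal.ofReal_le_ofReal ?_)
    calc (1 + c.Cmom) * (∑ l, t.weight h k l ^ 2) / (ℓ / σ) ^ 2
        ≤ (1 + c.Cmom) * (Cw / σ ^ 2) / (ℓ / σ) ^ 2 := by gcongr
      _ = _ := by rw [← hℓ2]; field_simp
  · exact le_iSup₂ (f := fun (w : Model d p n) (_ : w ∈ {w : Model d p n | InModelClass c t.X w}) =>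
      w.dataLaw t.X {y | ∃ i : Fin n, c.cvar / 2 * (n : ℝ) ^ (-(1 / (2 + d) - φ) : ℝ) <
        ‖Matrix.toEuclideanCLM (𝕜 := ℝ) (t.Sig n y i - w.cov i)‖}) w hw

/-! ### The two regimes -/

theorem four_mul_le_four_mul_sqrt (hd : 0 < d) {x : ℝ} (hx : 0 ≤ x) :
    4 * x ≤ 4 * √(d : ℝ) * x := by
  have : 1 ≤ √(d : ℝ) := Real.one_le_sqrt.mpr (by exact_mod_cast hd)
  nlinarith

/-- The condition on `C` leaves a signal of at least `hmin ^ ζ ≥ hmin ^ d` once `hmin < 1`.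
Multiplied by `σ / ℓ` it is at least `√(n * hmin ^ (3 d) / log n)`, which diverges by the rate
condition on `β`, as `β` is bounded. -/
theorem Assumptions.consistent_of_zeta_le (ha : t.Assumptions c) (hc : c.Valid) (hd : 0 < d)
    {D : ℝ} (hD0 : 0 < D) (hD : HalfspaceBound d c D) (hζ : c.ζ ≤ d) {C : ℝ}
    (hC : 2 * (D * 8 ^ c.ζ + 1) ≤ C) :
    t.UniformlyConsistent fun n => {w | InModelClass c t.X w ∧
      ENNReal.ofReal (C * t.hmin n ^ c.ζ) ≤ w.dist t.X (t.theta c.ζ n)} := by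
  have h8 : 0 < D * 8 ^ c.ζ := by positivity
  refine ha.uniformlyConsistent_of_bandwidths hc hD (j := t.k)
    (Eventually.of_forall fun _ => le_rfl) (Eventually.of_forall fun n => ?_)
    (Eventually.of_forall fun n => ?_) ?_
  · rw [theta, if_pos hζ]
    exact four_mul_le_four_mul_sqrt hd (ha.hmin_pos n).le
  · have := ha.hmin_pos n
    have hC0 : 0 < C := by linarith
    positivity
  · obtain ⟨Cβ, hβ⟩ := ha.β_le
    have hCβ : 0 < Cβ := (ha.β_pos 0).trans_le (hβ 0)
    have hlog : Tendsto (fun n : ℕ => Real.log n) atTop atTop :=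
      Real.tendsto_log_atTop.comp tendsto_natCast_atTop_atTop
    have hinv : Tendsto (fun n : ℕ =>
        (Real.log n ^ 4 / (t.β n ^ 10 * t.hmin n ^ (3 * d) * n))⁻¹) atTop atTop := by
      refine Tendsto.inv_tendsto_nhdsGT_zero (tendsto_nhdsWithin_iff.mpr ⟨ha.β_rate, ?_⟩)
      filter_upwards [hlog.eventually_gt_atTop 0, eventually_gt_atTop 0] with n hn hn0
      have h1 := ha.β_pos n
      have h2 := ha.hmin_pos n
      have h3 : (0 : ℝ) < n := by exact_mod_cast hn0
      simp only [Set.mem_Ioi]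
      positivity
    have hsqrt := Real.tendsto_sqrt_atTop.comp
      (hinv.atTop_div_const (show 0 < Cβ ^ 10 by positivity))
    refine tendsto_atTop_mono' _ ?_ hsqrt
    filter_upwards [hlog.eventually_ge_atTop 1, eventually_gt_atTop 0,
      ha.hmin_tendsto.eventually (gt_mem_nhds zero_lt_one)] with n hn hn0 hh1
    have hb := ha.β_pos n
    have hh := ha.hmin_pos n
    have hn' : (0 : ℝ) < n := by exact_mod_cast hn0
    change √((Real.log n ^ 4 / (t.β n ^ 10 * t.hmin n ^ (3 * d) * n))⁻¹ / Cβ ^ 10)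
      ≤ (C * t.hmin n ^ c.ζ / 2 - D * (8 * t.hmin n) ^ c.ζ)
        * (√(n * t.hmin n ^ d) / √(Real.log n))
    set h := t.hmin n
    set l := Real.log n
    have hl0 : 0 < l := by linarith
    have h1 : h ^ d ≤ C * h ^ c.ζ / 2 - D * (8 * h) ^ c.ζ := by
      have e1 : h ^ d ≤ h ^ c.ζ := by
        rw [← Real.rpow_natCast]
        exact Real.rpow_le_rpow_of_exponent_ge hh hh1.le hζ
      rw [Real.mul_rpow (by norm_num) hh.le]
      have e2 : 0 < h ^ c.ζ := by positivity
      nlinarith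
    have h2 : (l ^ 4 / (t.β n ^ 10 * h ^ (3 * d) * n))⁻¹ / Cβ ^ 10
        ≤ (h ^ d) ^ 2 * (n * h ^ d / l) := by
      have e1 : t.β n ^ 10 ≤ Cβ ^ 10 := by gcongr; exact hβ n
      have e2 : (l ^ 4 / (t.β n ^ 10 * h ^ (3 * d) * n))⁻¹ / Cβ ^ 10
          = (h ^ (3 * d) * n) * (t.β n ^ 10 / Cβ ^ 10) / l ^ 4 := by
        rw [inv_div]; field_simp
      have e3 : (h ^ d) ^ 2 * (n * h ^ d / l) = (h ^ (3 * d) * n) * 1 / l := by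
        rw [pow_mul']; ring
      rw [e2, e3]
      gcongr
      · exact div_le_one_of_le₀ e1 (by positivity)
      · exact le_self_pow₀ hn (by norm_num)
    calc √((l ^ 4 / (t.β n ^ 10 * h ^ (3 * d) * n))⁻¹ / Cβ ^ 10)
        ≤ √((h ^ d) ^ 2 * (n * h ^ d / l)) := Real.sqrt_le_sqrt h2
      _ = h ^ d * (√(n * h ^ d) / √l) := by
          rw [Real.sqrt_mul (by positivity), Real.sqrt_sq (by positivity),
            Real.sqrt_div' _ hl0.le]
      _ ≤ _ := by gcongr

theorem tendsto_rate (t : TestSetup d p) {ζ : ℝ} (hζ : 0 < ζ) :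
    Tendsto (t.rate ζ) atTop (𝓝 0) := by
  have h1 : Tendsto (fun n : ℕ => Real.log n / n) atTop (𝓝 0) :=
    (Real.isLittleO_log_id_atTop.tendsto_div_nhds_zero).comp tendsto_natCast_atTop_atTop
  have h2 : 0 < 1 / (2 * ζ + d) := by positivity
  have := h1.rpow_const (p := 1 / (2 * ζ + d)) (Or.inr h2.le)
  rwa [Real.zero_rpow h2.ne'] at this

/-- The first bandwidth not above `ρ` is not the largest one, and its predecessor exceeds `ρ`. -/
theorem Assumptions.exists_bandwidth (ha : t.Assumptions c) {n : ℕ} {ρ : ℝ}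
    (h1 : t.hmin n < ρ) (h2 : ρ < t.hmax) : ∃ j ≤ t.k n, t.bw j ≤ ρ ∧ t.a * ρ ≤ t.bw j := by
  classical
  have hex : ∃ j, t.bw j ≤ ρ := ⟨t.k n, h1.le⟩
  refine ⟨Nat.find hex, Nat.find_min' hex h1.le, Nat.find_spec hex, ?_⟩
  have h0 : Nat.find hex ≠ 0 := by
    intro h
    have := Nat.find_spec hex
    rw [h, bw, pow_zero, mul_one] at this
    linarith
  obtain ⟨q, hq⟩ := Nat.exists_eq_succ_of_ne_zero h0
  have h3 := not_le.mp (Nat.find_min hex (m := q) (by omega))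
  have hap := ha.a_pos
  calc t.a * ρ ≤ t.a * t.bw q := by gcongr
    _ = t.bw (Nat.find hex) := by rw [hq, bw, bw, pow_succ]; ring

theorem Assumptions.consistent_of_lt_zeta (ha : t.Assumptions c) (hc : c.Valid) (hd : 0 < d)
    {D : ℝ} (hD0 : 0 < D) (hD : HalfspaceBound d c D) (hζ : (d : ℝ) < c.ζ)
    (hmin : ∀ᶠ n : ℕ in atTop, t.hmin n < t.rate c.ζ n) {r : ℕ → ℝ}
    (hr : Tendsto (fun n : ℕ => r n * ((n : ℝ) / Real.log n) ^ (c.ζ / (2 * c.ζ + d)))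
      atTop atTop) :
    t.UniformlyConsistent fun n => {w | InModelClass c t.X w ∧
      ENNReal.ofReal (r n) ≤ w.dist t.X (t.theta c.ζ n)} := by
  classical
  have hζ0 : 0 < c.ζ := lt_of_le_of_lt (Nat.cast_nonneg d) hζ
  have hap := ha.a_pos
  have hlog : Tendsto (fun n : ℕ => Real.log n) atTop atTop :=
    Real.tendsto_log_atTop.comp tendsto_natCast_atTop_atTop
  have hev : ∀ᶠ n in atTop, ∃ j ≤ t.k n, t.bw j ≤ t.rate c.ζ n ∧ t.a * t.rate c.ζ n ≤ t.bw j := by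
    filter_upwards [hmin, (t.tendsto_rate hζ0).eventually (gt_mem_nhds ha.hmax_pos)] with n h1 h2
    exact ha.exists_bandwidth h1 h2
  -- The default `0` is taken for finitely many `n` at most.
  set j : ℕ → ℕ := fun n => if h : ∃ j ≤ t.k n, t.bw j ≤ t.rate c.ζ n ∧
    t.a * t.rate c.ζ n ≤ t.bw j then h.choose else 0 with hj
  have hjs : ∀ᶠ n in atTop, j n ≤ t.k n ∧ t.bw (j n) ≤ t.rate c.ζ n ∧
      t.a * t.rate c.ζ n ≤ t.bw (j n) := hev.mono fun n h => by
    rw [hj]; simp only [dif_pos h]; exact h.choose_spec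
  have hpos : ∀ᶠ n : ℕ in atTop, 0 < Real.log n ∧ (0 : ℝ) < n := by
    filter_upwards [hlog.eventually_gt_atTop 0, eventually_gt_atTop 0] with n h1 h2
    exact ⟨h1, by exact_mod_cast h2⟩
  refine ha.uniformlyConsistent_of_bandwidths hc hD (j := j) (hjs.mono fun n h => h.1)
    (hjs.mono fun n h => ?_) ?_ ?_
  · rw [theta, if_neg (not_le.mpr hζ)]
    have := ha.bw_pos (j n)
    exact (mul_le_mul_of_nonneg_left h.2.1 (by norm_num)).trans
      (four_mul_le_four_mul_sqrt hd (by linarith [h.2.1]))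
  · filter_upwards [hr.eventually_gt_atTop 0, hpos] with n h1 h2
    have h3 := h2.1
    have h4 := h2.2
    exact pos_of_mul_pos_left h1 (by positivity)
  · have hlow : Tendsto (fun n : ℕ => √(t.a ^ d) * (r n * ((n : ℝ) / Real.log n) ^
        (c.ζ / (2 * c.ζ + d)) / 2 - D * 8 ^ c.ζ)) atTop atTop :=
      (tendsto_atTop_add_const_right _ _ (hr.atTop_div_const zero_lt_two)).const_mul_atTop
        (Real.sqrt_pos.mpr (by positivity))
    refine tendsto_atTop_mono' _ ?_ hlow
    filter_upwards [hjs, hpos, hr.eventually_ge_atTop (2 * (D * 8 ^ c.ζ))] with n hjn hln hbig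
    obtain ⟨-, h1, h2⟩ := hjn
    obtain ⟨hl, hn⟩ := hln
    have hb := ha.bw_pos (j n)
    set ρ := t.rate c.ζ n with hρ
    set h := t.bw (j n)
    set l := Real.log n
    have hρ0 : 0 < ρ := hb.trans_le h1
    have hs : 0 < 2 * c.ζ + d := by positivity
    have hpow : ((n : ℝ) / l) ^ (c.ζ / (2 * c.ζ + d)) = (ρ ^ c.ζ)⁻¹ := by
      rw [hρ, rate, ← Real.rpow_mul (by positivity), ← Real.inv_rpow (by positivity), inv_div]
      congr 1; ring
    -- The rate `ρ` is defined by this balance of bias `ρ ^ ζ` and noise. Replacing `ρ` by a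
    -- bandwidth in `[a * ρ, ρ]` costs only the factor `√(a ^ d)`.
    have hunit : ρ ^ c.ζ * (√(n * ρ ^ d) / √l) = 1 := by
      have e1 : (ρ ^ c.ζ) ^ 2 * ρ ^ d = l / n := by
        rw [← Real.rpow_natCast, ← Real.rpow_natCast, ← Real.rpow_mul hρ0.le,
          ← Real.rpow_add hρ0, hρ, rate, ← Real.rpow_mul (by positivity)]
        rw [show 1 / (2 * c.ζ + d) * (c.ζ * (2 : ℕ) + (d : ℝ)) = 1 by
          push_cast; field_simp, Real.rpow_one]
      rw [← Real.sqrt_div' _ hl.le, ← Real.sqrt_sq (show 0 ≤ ρ ^ c.ζ by positivity),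
        ← Real.sqrt_mul (by positivity)]
      have e2 : (ρ ^ c.ζ) ^ 2 * (n * ρ ^ d / l) = 1 := by
        rw [show (ρ ^ c.ζ) ^ 2 * (n * ρ ^ d / l) = (ρ ^ c.ζ) ^ 2 * ρ ^ d * (n / l) by ring, e1]
        field_simp
      rw [e2, Real.sqrt_one]
    rw [hpow] at hbig ⊢
    have hsig : ρ ^ c.ζ * (r n * (ρ ^ c.ζ)⁻¹ / 2 - D * 8 ^ c.ζ)
        ≤ r n / 2 - D * (8 * h) ^ c.ζ := by
      have e1 : h ^ c.ζ ≤ ρ ^ c.ζ := by gcongr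
      have e2 : ρ ^ c.ζ * (r n * (ρ ^ c.ζ)⁻¹ / 2) = r n / 2 := by field_simp
      rw [Real.mul_rpow (by norm_num) hb.le, mul_sub, e2]
      have : 0 < D * 8 ^ c.ζ := by positivity
      nlinarith
    have hσ : √(t.a ^ d) * √(n * ρ ^ d) ≤ √(n * h ^ d) := by
      rw [← Real.sqrt_mul (by positivity)]
      refine Real.sqrt_le_sqrt ?_
      rw [show t.a ^ d * (n * ρ ^ d) = n * (t.a * ρ) ^ d by rw [mul_pow]; ring]
      gcongr
    have hnn : 0 ≤ r n * (ρ ^ c.ζ)⁻¹ / 2 - D * 8 ^ c.ζ := by linarith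
    calc √(t.a ^ d) * (r n * (ρ ^ c.ζ)⁻¹ / 2 - D * 8 ^ c.ζ)
        = ρ ^ c.ζ * (r n * (ρ ^ c.ζ)⁻¹ / 2 - D * 8 ^ c.ζ)
          * (√(t.a ^ d) * √(n * ρ ^ d) / √l) := by
          linear_combination (-(√(t.a ^ d) * (r n * (ρ ^ c.ζ)⁻¹ / 2 - D * 8 ^ c.ζ))) * hunit
      _ ≤ (r n / 2 - D * (8 * h) ^ c.ζ) * (√(n * h ^ d) / √l) := by
          have : 0 ≤ ρ ^ c.ζ * (r n * (ρ ^ c.ζ)⁻¹ / 2 - D * 8 ^ c.ζ) := by positivity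
          gcongr
          exact this.trans hsig

end TestSetup

end

theorem theorem4 (d p : ℕ) (hd : 0 < d) (hp : 0 < p) (c : ModelConstants) (hc : c.Valid) :
    (c.ζ ≤ d →
      ∃ C₀ : ℝ, 0 < C₀ ∧ ∀ t : TestSetup d p, t.Assumptions c → ∀ C : ℝ, C₀ ≤ C →
        t.UniformlyConsistent fun n =>
          {w | InModelClass c t.X w ∧
            ENNReal.ofReal (C * t.hmin n ^ c.ζ) ≤ w.dist t.X (t.theta c.ζ n)}) ∧
    ((d : ℝ) < c.ζ →
      ∀ t : TestSetup d p, t.Assumptions c →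
        (∀ᶠ n : ℕ in atTop, t.hmin n < t.rate c.ζ n) →
        ∀ r : ℕ → ℝ,
          Tendsto (fun n : ℕ => r n * ((n : ℝ) / Real.log n) ^ (c.ζ / (2 * c.ζ + d)))
            atTop atTop →
          t.UniformlyConsistent fun n =>
            {w | InModelClass c t.X w ∧
              ENNReal.ofReal (r n) ≤ w.dist t.X (t.theta c.ζ n)}) := by
  obtain ⟨D, hD0, hD⟩ := exists_halfspaceBound d hc
  exact ⟨fun hζ => ⟨2 * (D * 8 ^ c.ζ + 1), by positivity, fun t ha C hC =>
      ha.consistent_of_zeta_le hc hd hD0 hD hζ hC⟩,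
    fun hζ t ha hmin r hr => ha.consistent_of_lt_zeta hc hd hD0 hD hζ hmin hr⟩
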